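/- All Banach spaces are complex. For a finite family $(x_k)$ in a Banach space $E$, the unconditional basis constant $\chi((x_k))=\chi((x_k);E)$ is the best $c\ge 0$ such that $\|\sum_k \varepsilon_k a_k x_k\|\le c\,\|\sum_k a_k x_k\|$ for all scalars $a_k,\varepsilon_k\in\mathbb C$ with $|\varepsilon_k|\le 1$; a basis is $1$-unconditional if this inequality holds with $c=1$. For an operator $T:E\to F$ let $$\pi_1(T)=\sup\Big\{\sum_{i=1}^k\|Tx_i\| : k\in\mathbb N,\ x_1,\dots,x_k\in E,\ \Big\|\sum_{i=1}^k\lambda_i x_i\Big\|\le 1\text{ for all } |\lambda_i|\le 1\Big\},$$ let $\gamma_1(T)=\inf\|R\|\,\|S\|$, the infimum over all factorizations $T=SR$ with bounded operators $R:E\to L_1(\mu)$, $S:L_1(\mu)\to F$ and $\mu$ any measure, and let the Gordon–Lewis constant $\mathrm{gl}(E)$ be the best $c\ge 0$ such that $\gamma_1(T)\le c\,\pi_1(T)$ for every $T:E\to\ell_2$ with $\pi_1(T)<\infty$. For a norm on $\mathbb C^n$, with $X_n=(\mathbb C^n,\|\cdot\|)$, let $\mathcal P(^mX_n)$ be the space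 of $m$-homogeneous polynomials $p(z)=\sum_{|\alpha|=m}c_\alpha z^\alpha$ with $\|p\|=\sup_{\|z\|\le1}|p(z)|$, and let $\chi_{\mathrm{mon}}(\mathcal P(^mX_n))$ be the unconditional basis constant of the monomials $z^\alpha$, $|\alpha|=m$. For a Banach space $X$, let $\otimes^{m,s}X$ be the image of the symmetrization operator $S(y_1\otimes\cdots\otimes y_m)=\frac1{m!}\sum_{\sigma}y_{\sigma(1)}\otimes\cdots\otimes y_{\sigma(m)}$ on $\otimes^mX$. Write $\otimes^{m,s}_{\pi_s}X$ for this space with the symmetric projective norm $\pi_s(z)=\inf\{\sum_l|\lambda_l|\|x_l\|^m: z=\sum_l\lambda_l\,x_l\otimes\cdots\otimes x_l\}$, and $\otimes^{m,s}_{\varepsilon_s}X$ for this space with the symmetric injective norm $\varepsilon_s(z)=\sup\{|\langle \varphi\otimes\cdots\otimes\varphi,z\rangle|:\varphi\in X^*,\ \|\varphi\|\le1\}$. **Proposition.** (a) There is a constant $C\ge1$ such that for all $m,n\ge1$ and every norm on $\mathbb C^n$ for which the unit vectors $e_1,\dots,e_n$ form a $1$-unconditional basis of $X_n=(\mathbb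 C^n,\|\cdot\|)$, $$\chi_{\mathrm{mon}}(\mathcal P(^mX_n))\le C^m\,\mathrm{gl}(\mathcal P(^mX_n)).$$ (b) Let $m,n\ge1$, let $X$ be a Banach space with a $1$-unconditional basis $x_1,\dots,x_n$, and let $\alpha_s$ be either $\pi_s$ or $\varepsilon_s$. Then $$\chi\big((S(x_{j_1}\otimes\cdots\otimes x_{j_m}))_{1\le j_1\le\cdots\le j_m\le n};\ \otimes^{m,s}_{\alpha_s}X\big)\le\Big(\frac{m^m}{m!}\Big)^2\,2^m\;\mathrm{gl}\big(\otimes^{m,s}_{\alpha_s}X\big).$$ -/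

import Mathlib

open scoped ENNReal NNReal TensorProduct

noncomputable section

/-! ### Unconditional basis constants -/

section Unconditional

variable {ι : Type*} {E : Type*} [NormedAddCommGroup E] [NormedSpace ℂ E]

/-- The family `x` is `c`-unconditional: `‖∑ εₖ aₖ xₖ‖ ≤ c ‖∑ aₖ xₖ‖` for all finite sums, all
complex coefficients `aₖ` and all complex multipliers with `|εₖ| ≤ 1`. -/
def IsUnconditionalWith (c : ℝ≥0) (x : ι → E) : Prop :=
  ∀ (s : Finset ι) (ε a : ι → ℂ), (∀ k, ‖ε k‖ ≤ 1) →
    ‖∑ k ∈ s, (ε k * a k) • x k‖ ≤ c * ‖∑ k ∈ s, a k • x k‖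

/-- The unconditional basis constant `χ((xₖ))`: the best constant `c` such that the family is
`c`-unconditional (`∞` if there is none). -/
def unconditionalConstant (x : ι → E) : ℝ≥0∞ :=
  ⨅ (c : ℝ≥0) (_ : IsUnconditionalWith c x), (c : ℝ≥0∞)

end Unconditional

/-! ### The Gordon–Lewis constant -/

section GordonLewis

universe u

/-- The complex Hilbert space `ℓ₂`. -/
abbrev EllTwo : Type := lp (fun _ : ℕ => ℂ) 2

/-- The `1`-summing norm `π₁(T)`, with values in `[0, ∞]`: the supremum of `∑ ‖T xᵢ‖` over all
finite families with `‖∑ λᵢ xᵢ‖ ≤ 1` for all scalars `|λᵢ| ≤ 1`. -/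
def oneSummingNorm {E F : Type*} [NormedAddCommGroup E] [NormedSpace ℂ E]
    [NormedAddCommGroup F] [NormedSpace ℂ F] (T : E →L[ℂ] F) : ℝ≥0∞ :=
  ⨆ (k : ℕ) (x : Fin k → E)
    (_ : ∀ l : Fin k → ℂ, (∀ i, ‖l i‖ ≤ 1) → ‖∑ i, l i • x i‖ ≤ 1), ∑ i, ‖T (x i)‖ₑ

/-- The factorization norm `γ₁(T) = inf ‖R‖ ‖S‖` over all factorizations `T = S ∘ R` through some
`L₁(μ)`, where `μ` is an arbitrary measure (`∞` if there is no such factorization). -/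
def gammaOne {E : Type u} [NormedAddCommGroup E] [NormedSpace ℂ E] {F : Type*}
    [NormedAddCommGroup F] [NormedSpace ℂ F] (T : E →L[ℂ] F) : ℝ≥0∞ :=
  ⨅ (Ω : Type u) (_ : MeasurableSpace Ω) (μ : MeasureTheory.Measure Ω)
    (R : E →L[ℂ] MeasureTheory.Lp ℂ 1 μ) (S : MeasureTheory.Lp ℂ 1 μ →L[ℂ] F)
    (_ : S.comp R = T), ‖R‖ₑ * ‖S‖ₑ

/-- The Gordon–Lewis constant `gl(E)`: the best `c ≥ 0` with `γ₁(T) ≤ c π₁(T)` for every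
`1`-summing operator `T : E → ℓ₂` (`∞` if there is none). -/
def gordonLewis (E : Type u) [NormedAddCommGroup E] [NormedSpace ℂ E] : ℝ≥0∞ :=
  ⨅ (c : ℝ≥0) (_ : ∀ T : E →L[ℂ] EllTwo, oneSummingNorm T ≠ ∞ →
    gammaOne T ≤ c * oneSummingNorm T), (c : ℝ≥0∞)

end GordonLewis

/-! ### Norms on `ℂⁿ` and spaces of homogeneous polynomials -/

/-- A norm on the vector space `ℂⁿ`. -/
structure CnNorm (n : ℕ) extends Seminorm ℂ (Fin n → ℂ) where
  eq_zero_of_toFun_eq_zero : ∀ z, toFun z = 0 → z = 0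

namespace CnNorm

variable {n : ℕ}

/-- The Banach space `X = (ℂⁿ, ‖·‖)`. -/
def Space (_N : CnNorm n) : Type := Fin n → ℂ

variable (N : CnNorm n)

instance : AddCommGroup N.Space := inferInstanceAs (AddCommGroup (Fin n → ℂ))

instance : Module ℂ N.Space := inferInstanceAs (Module ℂ (Fin n → ℂ))

instance : FiniteDimensional ℂ N.Space :=
  inferInstanceAs (FiniteDimensional ℂ (Fin n → ℂ))

instance : Norm N.Space := ⟨fun z => N.toSeminorm z⟩

theorem core : NormedSpace.Core ℂ N.Space where
  norm_nonneg z := apply_nonneg N.toSeminorm z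
  norm_smul c z := map_smul_eq_mul N.toSeminorm c z
  norm_triangle z w := map_add_le_add N.toSeminorm z w
  norm_eq_zero_iff z :=
    ⟨fun h => N.eq_zero_of_toFun_eq_zero z h, fun h => by rw [h]; exact map_zero N.toSeminorm⟩

instance : NormedAddCommGroup N.Space := NormedAddCommGroup.ofCore N.core

instance : NormedSpace ℂ N.Space := NormedSpace.ofCore N.core

/-- The coordinates of a point of `X = (ℂⁿ, ‖·‖)`. -/
def coords : N.Space →ₗ[ℂ] (Fin n → ℂ) := LinearMap.id

/-- The standard unit vector `e_k`, as an element of `X = (ℂⁿ, ‖·‖)`. -/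
def unitVector (k : Fin n) : N.Space := (Pi.single k 1 : Fin n → ℂ)

end CnNorm

/-- The space `𝒫(ᵐX)` of `m`-homogeneous polynomials `∑_{|α|=m} c_α z^α` on `X = (ℂⁿ, ‖·‖)`. -/
def HomPoly {n : ℕ} (_N : CnNorm n) (m : ℕ) : Type :=
  MvPolynomial.homogeneousSubmodule (Fin n) ℂ m

namespace HomPoly

variable {n : ℕ} (N : CnNorm n) (m : ℕ)

instance : AddCommGroup (HomPoly N m) :=
  inferInstanceAs (AddCommGroup (MvPolynomial.homogeneousSubmodule (Fin n) ℂ m))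

instance : Module ℂ (HomPoly N m) :=
  inferInstanceAs (Module ℂ (MvPolynomial.homogeneousSubmodule (Fin n) ℂ m))

/-- The underlying formal polynomial. -/
def toMvPolynomial : HomPoly N m →ₗ[ℂ] MvPolynomial (Fin n) ℂ :=
  (MvPolynomial.homogeneousSubmodule (Fin n) ℂ m).subtype

variable {N m}

/-- The value `p(z)` of the polynomial `p` at the point `z` of `X`. -/
def evalAt (p : HomPoly N m) (z : N.Space) : ℂ :=
  MvPolynomial.eval (N.coords z) (toMvPolynomial N m p)

/-- The norm `‖p‖ = sup {|p(z)| : ‖z‖ ≤ 1}`. -/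
instance : Norm (HomPoly N m) := ⟨fun p => ⨆ z : {z : N.Space // ‖z‖ ≤ 1}, ‖evalAt p z‖⟩

theorem norm_def (p : HomPoly N m) : ‖p‖ = ⨆ z : {z : N.Space // ‖z‖ ≤ 1}, ‖evalAt p z‖ := rfl

theorem bddAbove (p : HomPoly N m) :
    BddAbove (Set.range fun z : {z : N.Space // ‖z‖ ≤ 1} => ‖evalAt p z‖) := by
  have : ProperSpace N.Space := FiniteDimensional.proper ℂ N.Space
  have hc : Continuous fun z : N.Space => ‖evalAt p z‖ :=
    ((MvPolynomial.continuous_eval (toMvPolynomial N m p)).comp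
      (LinearMap.continuous_of_finiteDimensional N.coords)).norm
  obtain ⟨C, hC⟩ :=
    (isCompact_closedBall (0 : N.Space) 1).bddAbove_image hc.continuousOn
  refine ⟨C, ?_⟩
  rintro _ ⟨⟨z, hz⟩, rfl⟩
  exact hC ⟨z, by simpa using hz, rfl⟩

theorem le_norm (p : HomPoly N m) {z : N.Space} (hz : ‖z‖ ≤ 1) : ‖evalAt p z‖ ≤ ‖p‖ :=
  le_ciSup (f := fun z : {z : N.Space // ‖z‖ ≤ 1} => ‖evalAt p z‖) (bddAbove p) ⟨z, hz⟩

theorem evalAt_smul (p : HomPoly N m) (c : ℂ) (z : N.Space) :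
    evalAt p (c • z) = c ^ m * evalAt p z := by
  have h : (toMvPolynomial N m p).IsHomogeneous m := p.2
  rw [evalAt, evalAt, map_smul]
  rw [MvPolynomial.eval_eq, MvPolynomial.eval_eq, Finset.mul_sum]
  refine Finset.sum_congr rfl fun d hd => ?_
  have hdm : ∑ i ∈ d.support, d i = m := by
    have := h (MvPolynomial.mem_support_iff.mp hd)
    rw [← this, Finsupp.weight_apply, Finsupp.sum]
    simp
  simp only [Pi.smul_apply, smul_eq_mul, mul_pow, Finset.prod_mul_distrib,
    Finset.prod_pow_eq_pow_sum, hdm]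
  ring

theorem core : NormedSpace.Core ℂ (HomPoly N m) where
  norm_nonneg p := Real.iSup_nonneg fun _ => norm_nonneg _
  norm_smul c p := by
    rw [norm_def, norm_def, Real.mul_iSup_of_nonneg (norm_nonneg c)]
    refine iSup_congr fun z => ?_
    simp [evalAt]
  norm_triangle p q := by
    have : Nonempty {z : N.Space // ‖z‖ ≤ 1} := ⟨⟨0, by simp⟩⟩
    refine ciSup_le fun z => ?_
    have : evalAt (p + q) z = evalAt p z + evalAt q z := by simp [evalAt]
    rw [this]
    exact (norm_add_le _ _).trans (add_le_add (le_norm p z.2) (le_norm q z.2))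
  norm_eq_zero_iff p := by
    constructor
    · intro h
      have h0 : ∀ z : N.Space, ‖z‖ ≤ 1 → evalAt p z = 0 := fun z hz =>
        norm_le_zero_iff.mp (h ▸ le_norm p hz)
      have h1 : ∀ z : N.Space, evalAt p z = 0 := by
        intro z
        by_cases hz : ‖z‖ = 0
        · exact h0 z (by rw [hz]; exact zero_le_one)
        · have hz' : (‖z‖ : ℂ) ≠ 0 := by exact_mod_cast hz
          have h2 := h0 ((‖z‖ : ℂ)⁻¹ • z) (by rw [norm_smul]; simp [hz])
          rw [evalAt_smul] at h2
          rcases mul_eq_zero.mp h2 with h3 | h3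
          · exact absurd h3 (pow_ne_zero _ (inv_ne_zero hz'))
          · exact h3
      exact Subtype.ext (MvPolynomial.funext fun z =>
        (h1 z).trans (map_zero (MvPolynomial.eval z)).symm)
    · rintro rfl
      simp [norm_def, evalAt]

instance : NormedAddCommGroup (HomPoly N m) := NormedAddCommGroup.ofCore core

instance : NormedSpace ℂ (HomPoly N m) := NormedSpace.ofCore core

variable (N m)

/-- The monomial `z^α`, for a multi-index `α` with `|α| = m`. -/
def monomial (α : {α : Fin n →₀ ℕ // α.degree = m}) : HomPoly N m :=
  ⟨MvPolynomial.monomial α.1 1, MvPolynomial.isHomogeneous_monomial 1 α.2⟩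

end HomPoly

/-! ### Symmetric tensor powers -/

section Polarization

/-- Polarization, with the multipliers `0` and `1`. -/
theorem polarization_identity {m : ℕ} {V W : Type*} [AddCommGroup V] [Module ℂ V]
    [AddCommGroup W] [Module ℂ W] (F : MultilinearMap ℂ (fun _ : Fin m => V) W)
    (x : Fin m → V) :
    ∑ σ : Equiv.Perm (Fin m), F (fun i => x (σ i)) =
      ∑ c : Fin m → Fin 2, (∏ k, (2 * ((c k : ℕ) : ℂ) - 1)) •
        F (fun _ => ∑ k, ((c k : ℕ) : ℂ) • x k) := by
  classical
  have hcoef : ∀ r : Fin m → Fin m,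
      ∑ c : Fin m → Fin 2, (∏ k, (2 * ((c k : ℕ) : ℂ) - 1)) * ∏ i, ((c (r i) : ℕ) : ℂ) =
        if Function.Bijective r then 1 else 0 := by
    intro r
    have h1 : ∀ c : Fin m → Fin 2,
        (∏ k, (2 * ((c k : ℕ) : ℂ) - 1)) * ∏ i, ((c (r i) : ℕ) : ℂ) =
          ∏ k, (2 * ((c k : ℕ) : ℂ) - 1) *
            ((c k : ℕ) : ℂ) ^ (Finset.univ.filter fun i => r i = k).card := by
      intro c
      rw [Finset.prod_mul_distrib]
      congr 1
      rw [← Finset.prod_fiberwise (s := Finset.univ) (g := r)]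
      refine Finset.prod_congr rfl fun k _ => ?_
      rw [← Finset.prod_const]
      refine Finset.prod_congr rfl fun i hi => ?_
      rw [(Finset.mem_filter.mp hi).2]
    simp_rw [h1]
    rw [← Fintype.prod_sum (fun k (j : Fin 2) => (2 * ((j : ℕ) : ℂ) - 1) *
            ((j : ℕ) : ℂ) ^ (Finset.univ.filter fun i => r i = k).card)]
    simp only [Fin.sum_univ_two]
    split_ifs with h
    · refine Finset.prod_eq_one fun k _ => ?_
      obtain ⟨i, hi⟩ := h.2 k
      have : (Finset.univ.filter fun i => r i = k).card ≠ 0 :=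
        Finset.card_ne_zero_of_mem (Finset.mem_filter.mpr ⟨Finset.mem_univ i, hi⟩)
      simp [this]
      norm_num
    · have hs : ¬ Function.Surjective r := fun hs => h (Finite.surjective_iff_bijective.mp hs)
      simp only [Function.Surjective, not_forall, not_exists] at hs
      obtain ⟨k, hk⟩ := hs
      refine Finset.prod_eq_zero (Finset.mem_univ k) ?_
      have : (Finset.univ.filter fun i => r i = k) = ∅ := by
        simp [hk]
      rw [this]
      norm_num
  have hF : ∀ c : Fin m → Fin 2, F (fun _ => ∑ k, ((c k : ℕ) : ℂ) • x k) =
      ∑ r : Fin m → Fin m, (∏ i, ((c (r i) : ℕ) : ℂ)) • F (fun i => x (r i)) := by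
    intro c
    rw [F.map_sum]
    exact Finset.sum_congr rfl fun r _ => F.map_smul_univ _ _
  simp_rw [hF, Finset.smul_sum, smul_smul]
  rw [Finset.sum_comm]
  simp_rw [← Finset.sum_smul, hcoef, ite_smul, one_smul, zero_smul]
  rw [← Finset.sum_filter]
  refine Finset.sum_bij (fun σ _ => ⇑σ) (fun σ _ => Finset.mem_filter.mpr ⟨Finset.mem_univ _, σ.bijective⟩)
    (fun σ _ τ _ h => Equiv.coe_fn_injective h)
    (fun r hr => ⟨Equiv.ofBijective r (Finset.mem_filter.mp hr).2, Finset.mem_univ _, rfl⟩)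
    (fun σ _ => rfl)

end Polarization

section SymmetricTensors

variable (m : ℕ) (X : Type*) [NormedAddCommGroup X] [NormedSpace ℂ X]

/-- The symmetrization operator
`S(y₁ ⊗ ⋯ ⊗ y_m) = (1/m!) ∑_σ y_{σ(1)} ⊗ ⋯ ⊗ y_{σ(m)}` on the `m`th full tensor power. -/
def symmetrization : (⨂[ℂ] _ : Fin m, X) →ₗ[ℂ] ⨂[ℂ] _ : Fin m, X :=
  (Nat.factorial m : ℂ)⁻¹ • ∑ σ : Equiv.Perm (Fin m), PiTensorProduct.lift
    ((PiTensorProduct.tprod ℂ : MultilinearMap ℂ (fun _ : Fin m => X) _).domDomCongr σ)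

theorem symmetrization_tprod (y : Fin m → X) :
    symmetrization m X (⨂ₜ[ℂ] i, y i) =
      (Nat.factorial m : ℂ)⁻¹ • ∑ σ : Equiv.Perm (Fin m), ⨂ₜ[ℂ] i, y (σ i) := by
  simp [symmetrization, LinearMap.sum_apply]

/-- The two norms on symmetric tensor powers: the symmetric projective norm `π_s` and the
symmetric injective norm `ε_s`. -/
inductive SymTensorNorm
  | projective
  | injective

variable {m X}

/-- The diagonal tensor `x ⊗ ⋯ ⊗ x`. -/
def diagTensor (m : ℕ) {X : Type*} [NormedAddCommGroup X] [NormedSpace ℂ X] (x : X) :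
    ⨂[ℂ] _ : Fin m, X := ⨂ₜ[ℂ] _ : Fin m, x

/-- The pairing `⟨φ ⊗ ⋯ ⊗ φ, z⟩` of a tensor with a power of a functional `φ ∈ X*`, which sends
`x₁ ⊗ ⋯ ⊗ x_m` to `φ(x₁) ⋯ φ(x_m)`. -/
def powerPairing (φ : StrongDual ℂ X) : (⨂[ℂ] _ : Fin m, X) →ₗ[ℂ] ℂ :=
  PiTensorProduct.dualDistrib (⨂ₜ[ℂ] _ : Fin m, (φ : Module.Dual ℂ X))

/-- The symmetric projective norm
`π_s(z) = inf {∑ |λ_l| ‖x_l‖^m : z = ∑ λ_l x_l ⊗ ⋯ ⊗ x_l}`. -/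
def symProjNorm (z : ⨂[ℂ] _ : Fin m, X) : ℝ :=
  sInf {r : ℝ | ∃ (k : ℕ) (l : Fin k → ℂ) (x : Fin k → X),
    z = ∑ i, l i • diagTensor m (x i) ∧ r = ∑ i, ‖l i‖ * ‖x i‖ ^ m}

/-- The symmetric injective norm
`ε_s(z) = sup {|⟨φ ⊗ ⋯ ⊗ φ, z⟩| : φ ∈ X*, ‖φ‖ ≤ 1}`. -/
def symInjNorm (z : ⨂[ℂ] _ : Fin m, X) : ℝ :=
  ⨆ φ : {φ : StrongDual ℂ X // ‖φ‖ ≤ 1}, ‖powerPairing φ.1 z‖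

/-- The norm on symmetric tensors named by `α`. -/
def SymTensorNorm.toFun (α : SymTensorNorm) (z : ⨂[ℂ] _ : Fin m, X) : ℝ :=
  match α with
  | .projective => symProjNorm z
  | .injective => symInjNorm z

variable (m X)

/-- The `m`th symmetric tensor power of `X`, i.e. the image of the symmetrization operator, to be
equipped with the norm named by `α`. -/
def SymTensorPower (_α : SymTensorNorm) : Type _ := LinearMap.range (symmetrization m X)

variable {m X}

namespace SymTensorPower

variable {α : SymTensorNorm}

instance : AddCommGroup (SymTensorPower m X α) :=
  inferInstanceAs (AddCommGroup (LinearMap.range (symmetrization m X)))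

instance : Module ℂ (SymTensorPower m X α) :=
  inferInstanceAs (Module ℂ (LinearMap.range (symmetrization m X)))

/-- The underlying element of the full tensor power. -/
def toTensor : SymTensorPower m X α →ₗ[ℂ] ⨂[ℂ] _ : Fin m, X :=
  (LinearMap.range (symmetrization m X)).subtype

instance : Norm (SymTensorPower m X α) := ⟨fun z => α.toFun (toTensor z)⟩

theorem exists_rep (z : SymTensorPower m X α) : ∃ (k : ℕ) (l : Fin k → ℂ) (x : Fin k → X),
    toTensor z = ∑ i, l i • diagTensor m (x i) := by
  obtain ⟨_, w, rfl⟩ := z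
  change ∃ (k : ℕ) (l : Fin k → ℂ) (x : Fin k → X),
    symmetrization m X w = ∑ i, l i • diagTensor m (x i)
  have hspan : symmetrization m X w ∈
      Submodule.span ℂ (Set.range (diagTensor m : X → ⨂[ℂ] _ : Fin m, X)) := by
    induction w using PiTensorProduct.induction_on with
    | smul_tprod r y =>
      rw [map_smul, symmetrization_tprod,
        polarization_identity (PiTensorProduct.tprod ℂ) y]
      refine Submodule.smul_mem _ _ (Submodule.smul_mem _ _ (Submodule.sum_mem _ fun c _ => ?_))
      exact Submodule.smul_mem _ _ (Submodule.subset_span ⟨_, rfl⟩)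
    | add a b ha hb => rw [map_add]; exact Submodule.add_mem _ ha hb
  obtain ⟨k, l, g, h⟩ := Submodule.mem_span_set'.mp hspan
  choose x hx using fun i => (g i).2
  exact ⟨k, l, x, by rw [← h]; simp_rw [hx]⟩

theorem norm_powerPairing_le {φ : StrongDual ℂ X} (hφ : ‖φ‖ ≤ 1) {k : ℕ} (l : Fin k → ℂ)
    (x : Fin k → X) :
    ‖powerPairing φ (∑ i, l i • diagTensor m (x i))‖ ≤ ∑ i, ‖l i‖ * ‖x i‖ ^ m := by
  rw [map_sum]
  refine (norm_sum_le _ _).trans (Finset.sum_le_sum fun i _ => ?_)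
  have : powerPairing φ (diagTensor m (x i)) = φ (x i) ^ m := by
    simp [powerPairing, diagTensor]
  rw [map_smul, this, smul_eq_mul, norm_mul, norm_pow]
  gcongr
  exact (φ.le_opNorm _).trans (mul_le_of_le_one_left (norm_nonneg _) hφ)

theorem bddAbove (z : SymTensorPower m X α) :
    BddAbove (Set.range fun φ : {φ : StrongDual ℂ X // ‖φ‖ ≤ 1} =>
      ‖powerPairing φ.1 (toTensor z)‖) := by
  obtain ⟨k, l, x, h⟩ := exists_rep z
  refine ⟨∑ i, ‖l i‖ * ‖x i‖ ^ m, ?_⟩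
  rintro _ ⟨φ, rfl⟩
  rw [h]
  exact norm_powerPairing_le φ.2 l x

theorem le_symInjNorm (z : SymTensorPower m X α) {φ : StrongDual ℂ X} (hφ : ‖φ‖ ≤ 1) :
    ‖powerPairing φ (toTensor z)‖ ≤ symInjNorm (toTensor z) :=
  le_ciSup (f := fun φ : {φ : StrongDual ℂ X // ‖φ‖ ≤ 1} => ‖powerPairing φ.1 (toTensor z)‖)
    (bddAbove z) ⟨φ, hφ⟩

theorem symInjNorm_le_symProjNorm (z : SymTensorPower m X α) :
    symInjNorm (toTensor z) ≤ symProjNorm (toTensor z) := by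
  have : Nonempty {φ : StrongDual ℂ X // ‖φ‖ ≤ 1} := ⟨⟨0, by simp⟩⟩
  obtain ⟨k, l, x, h⟩ := exists_rep z
  refine le_csInf ⟨_, k, l, x, h, rfl⟩ ?_
  rintro r ⟨k, l, x, h, rfl⟩
  refine ciSup_le fun φ => ?_
  rw [h]
  exact norm_powerPairing_le φ.2 l x

theorem symProjNorm_le {z : ⨂[ℂ] _ : Fin m, X} {k : ℕ} (l : Fin k → ℂ) (x : Fin k → X)
    (h : z = ∑ i, l i • diagTensor m (x i)) : symProjNorm z ≤ ∑ i, ‖l i‖ * ‖x i‖ ^ m :=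
  csInf_le ⟨0, by rintro r ⟨k, l, x, -, rfl⟩; positivity⟩ ⟨k, l, x, h, rfl⟩

theorem symProjNorm_nonneg (z : ⨂[ℂ] _ : Fin m, X) : 0 ≤ symProjNorm z :=
  Real.sInf_nonneg (by rintro r ⟨k, l, x, -, rfl⟩; positivity)

theorem exists_rep_lt (z : SymTensorPower m X α) {δ : ℝ} (hδ : 0 < δ) :
    ∃ (k : ℕ) (l : Fin k → ℂ) (x : Fin k → X),
      toTensor z = ∑ i, l i • diagTensor m (x i) ∧
        ∑ i, ‖l i‖ * ‖x i‖ ^ m < symProjNorm (toTensor z) + δ := by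
  obtain ⟨k, l, x, h⟩ := exists_rep z
  obtain ⟨r, ⟨k, l, x, h, rfl⟩, hr⟩ := exists_lt_of_csInf_lt
    (s := {r : ℝ | ∃ (k : ℕ) (l : Fin k → ℂ) (x : Fin k → X),
      toTensor z = ∑ i, l i • diagTensor m (x i) ∧ r = ∑ i, ‖l i‖ * ‖x i‖ ^ m})
    ⟨_, k, l, x, h, rfl⟩ (lt_add_of_pos_right (symProjNorm (toTensor z)) hδ)
  exact ⟨k, l, x, h, hr⟩

theorem symProjNorm_smul_le (c : ℂ) (z : SymTensorPower m X α) :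
    symProjNorm (toTensor (c • z)) ≤ ‖c‖ * symProjNorm (toTensor z) := by
  refine le_of_forall_pos_le_add fun δ hδ => ?_
  have hpos : (0 : ℝ) < ‖c‖ + 1 := by positivity
  obtain ⟨k, l, x, h, hr⟩ := exists_rep_lt z (div_pos hδ hpos)
  have h1 : toTensor (c • z) = ∑ i, (c * l i) • diagTensor m (x i) := by
    rw [map_smul, h, Finset.smul_sum]
    simp_rw [smul_smul]
  refine (symProjNorm_le _ _ h1).trans ?_
  simp_rw [norm_mul, mul_assoc]
  rw [← Finset.mul_sum]
  calc ‖c‖ * ∑ i, ‖l i‖ * ‖x i‖ ^ m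
      ≤ ‖c‖ * (symProjNorm (toTensor z) + δ / (‖c‖ + 1)) := by gcongr
    _ = ‖c‖ * symProjNorm (toTensor z) + ‖c‖ * (δ / (‖c‖ + 1)) := by ring
    _ ≤ ‖c‖ * symProjNorm (toTensor z) + δ := by
      gcongr
      rw [mul_div_assoc', div_le_iff₀ hpos]
      nlinarith

theorem symProjNorm_add_le (z w : SymTensorPower m X α) :
    symProjNorm (toTensor (z + w)) ≤ symProjNorm (toTensor z) + symProjNorm (toTensor w) := by
  refine le_of_forall_pos_le_add fun δ hδ => ?_
  obtain ⟨k, l, x, h, hr⟩ := exists_rep_lt z (half_pos hδ)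
  obtain ⟨k', l', x', h', hr'⟩ := exists_rep_lt w (half_pos hδ)
  have h1 : toTensor (z + w) =
      ∑ i, (Fin.append l l' i) • diagTensor m (Fin.append x x' i) := by
    rw [map_add, h, h', Fin.sum_univ_add]
    simp
  refine (symProjNorm_le _ _ h1).trans ?_
  rw [Fin.sum_univ_add]
  simp only [Fin.append_left, Fin.append_right]
  linarith

/-- A symmetric tensor on which all powers of functionals vanish is zero. -/
theorem eq_zero_of_powerPairing (z : SymTensorPower m X α)
    (hz : ∀ φ : StrongDual ℂ X, powerPairing φ (toTensor z) = 0) : z = 0 := by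
  obtain ⟨k, l, x, h⟩ := exists_rep z
  -- all products of functionals vanish on the tensor
  have hall : ∀ φ : Fin m → StrongDual ℂ X, ∑ i, l i * ∏ j, φ j (x i) = 0 := by
    intro φ
    let F : MultilinearMap ℂ (fun _ : Fin m => StrongDual ℂ X) ℂ :=
      ∑ i, l i • (MultilinearMap.mkPiAlgebra ℂ (Fin m) ℂ).compLinearMap
        (fun _ => (LinearMap.applyₗ (x i)) ∘ₗ ContinuousLinearMap.coeLM ℂ)
    have hF : ∀ ψ : Fin m → StrongDual ℂ X, F ψ = ∑ i, l i * ∏ j, ψ j (x i) := by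
      intro ψ
      simp [F]
    have hdiag : ∀ ψ : StrongDual ℂ X, F (fun _ => ψ) = 0 := by
      intro ψ
      rw [hF, ← hz ψ, h, map_sum]
      refine Finset.sum_congr rfl fun i _ => ?_
      simp [powerPairing, diagTensor]
    have hp := polarization_identity F φ
    simp_rw [hdiag, smul_zero, Finset.sum_const_zero, hF] at hp
    have hs : ∀ σ : Equiv.Perm (Fin m),
        ∑ i, l i * ∏ j, φ (σ j) (x i) = ∑ i, l i * ∏ j, φ j (x i) := fun σ =>
      Finset.sum_congr rfl fun i _ => by
        rw [Equiv.prod_comp σ (fun j => φ j (x i))]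
    simp_rw [hs, Finset.sum_const, nsmul_eq_mul] at hp
    refine (mul_eq_zero.mp hp).resolve_left ?_
    simp [Finset.card_univ, Fintype.card_perm, Nat.factorial_ne_zero]
  -- reduction to a finite dimensional subspace
  let V : Submodule ℂ X := Submodule.span ℂ (Set.range x)
  have : FiniteDimensional ℂ V := FiniteDimensional.span_of_finite ℂ (Set.finite_range x)
  let b := Module.finBasis ℂ V
  let y : Fin k → V := fun i => ⟨x i, Submodule.subset_span ⟨i, rfl⟩⟩
  let w : ⨂[ℂ] _ : Fin m, V := ∑ i, l i • ⨂ₜ[ℂ] _ : Fin m, y i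
  have hw : PiTensorProduct.map (fun _ : Fin m => V.subtype) w = toTensor z := by
    rw [h, map_sum]
    refine Finset.sum_congr rfl fun i _ => ?_
    rw [map_smul, PiTensorProduct.map_tprod]
    rfl
  have hw0 : w = 0 := by
    refine (Basis.piTensorProduct fun _ : Fin m => b).ext_elem fun p => ?_
    have hext : ∀ j : Fin m, ∃ g : StrongDual ℂ X, ∀ v : V, g v = b.coord (p j) v := by
      intro j
      obtain ⟨g, hg, -⟩ := exists_extension_norm_eq V
        (LinearMap.toContinuousLinearMap (b.coord (p j)))
      exact ⟨g, fun v => by rw [hg]; rfl⟩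
    choose g hg using hext
    have := hall g
    have hy : ∀ i j, b.repr (y i) (p j) = g j (x i) := fun i j => (hg j (y i)).symm
    simp [w, Finsupp.finsetSum_apply, hy, this]
  apply Subtype.ext
  change toTensor z = 0
  rw [← hw, hw0, map_zero]

theorem eq_zero_of_symInjNorm (z : SymTensorPower m X α) (h : symInjNorm (toTensor z) = 0) :
    z = 0 := by
  refine eq_zero_of_powerPairing z fun φ => ?_
  have hpos : (0 : ℝ) < ‖φ‖ + 1 := by positivity
  have hc : ((‖φ‖ + 1 : ℝ) : ℂ)⁻¹ ≠ 0 := inv_ne_zero (by exact_mod_cast hpos.ne')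
  set c : ℂ := ((‖φ‖ + 1 : ℝ) : ℂ)⁻¹ with hcdef
  have hn : ‖c • φ‖ ≤ 1 := by
    rw [norm_smul, hcdef, norm_inv, Complex.norm_real, Real.norm_of_nonneg hpos.le,
      inv_mul_le_iff₀ hpos]
    linarith
  have h0 : powerPairing (c • φ) (toTensor z) = 0 :=
    norm_le_zero_iff.mp (h ▸ le_symInjNorm z hn)
  obtain ⟨k, l, x, hx⟩ := exists_rep z
  have hscale : powerPairing (c • φ) (toTensor z) = c ^ m * powerPairing φ (toTensor z) := by
    rw [hx, map_sum, map_sum, Finset.mul_sum]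
    refine Finset.sum_congr rfl fun i _ => ?_
    simp [powerPairing, diagTensor, mul_pow]
    ring
  rw [hscale] at h0
  exact (mul_eq_zero.mp h0).resolve_left (pow_ne_zero _ hc)

theorem core : NormedSpace.Core ℂ (SymTensorPower m X α) := by
  cases α with
  | projective =>
    refine ⟨⟨fun z => symProjNorm_nonneg _, fun c z => ?_, symProjNorm_add_le⟩, fun z => ?_⟩
    · refine le_antisymm (symProjNorm_smul_le c z) ?_
      change ‖c‖ * symProjNorm (toTensor z) ≤ symProjNorm (toTensor (c • z))
      by_cases hc : c = 0
      · simp only [hc, norm_zero, zero_mul]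
        exact symProjNorm_nonneg _
      · have := symProjNorm_smul_le c⁻¹ (c • z)
        rw [inv_smul_smul₀ hc, norm_inv] at this
        rwa [← le_inv_mul_iff₀ (norm_pos_iff.mpr hc)]
    · constructor
      · intro h
        refine eq_zero_of_symInjNorm z (le_antisymm ?_ (Real.iSup_nonneg fun _ => norm_nonneg _))
        exact (symInjNorm_le_symProjNorm z).trans h.le
      · rintro rfl
        refine le_antisymm ?_ (symProjNorm_nonneg _)
        refine (symProjNorm_le (k := 0) (fun i => i.elim0) (fun i => i.elim0) ?_).trans ?_
        · simp
        · simp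
  | injective =>
    have : Nonempty {φ : StrongDual ℂ X // ‖φ‖ ≤ 1} := ⟨⟨0, by simp⟩⟩
    refine ⟨⟨fun z => Real.iSup_nonneg fun _ => norm_nonneg _, fun c z => ?_, fun z w => ?_⟩,
      fun z => ⟨eq_zero_of_symInjNorm z, ?_⟩⟩
    · change symInjNorm (toTensor (c • z)) = ‖c‖ * symInjNorm (toTensor z)
      rw [symInjNorm, symInjNorm, Real.mul_iSup_of_nonneg (norm_nonneg c)]
      exact iSup_congr fun φ => by rw [map_smul, map_smul, norm_smul]
    · refine ciSup_le fun φ => ?_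
      rw [map_add, map_add]
      exact (norm_add_le _ _).trans (add_le_add (le_symInjNorm z φ.2) (le_symInjNorm w φ.2))
    · rintro rfl
      change symInjNorm (toTensor (0 : SymTensorPower m X .injective)) = 0
      simp [symInjNorm]

instance : NormedAddCommGroup (SymTensorPower m X α) := NormedAddCommGroup.ofCore core

instance : NormedSpace ℂ (SymTensorPower m X α) := NormedSpace.ofCore core

variable (α)

/-- The symmetrized elementary tensor `S(y₁ ⊗ ⋯ ⊗ y_m)`. -/
def sym (y : Fin m → X) : SymTensorPower m X α :=
  ⟨symmetrization m X (⨂ₜ[ℂ] i, y i), LinearMap.mem_range_self _ _⟩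

end SymTensorPower

end SymmetricTensors

end

/-!
Both parts follow from one statement about a finite-dimensional space `E` with a basis `(xₖ)`: if
there are distinct multi-indices `wₖ` of order `m` such that `xₖ ↦ θ^{wₖ} xₖ` defines a contraction
`D_θ` for all points `θ` of the torus, then `χ((xₖ)) ≤ (2m choose m) gl(E)`
(`unconditionalConstant_le_choose_mul_gordonLewis`). For homogeneous polynomials `D_θ` is
`p ↦ p(θ ·)`, and for symmetric tensors it is `d_θ ⊗ ⋯ ⊗ d_θ` with the diagonal map `d_θ` of `X`;
`1`-unconditionality makes these contractions. Finally `(2m choose m) ≤ 4ᵐ`, and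
`(2m choose m) ≤ (mᵐ/m!)² 2ᵐ` since `(2m)! ≤ 2ᵐ (mᵐ)²`.

The analytic input is the inequality `‖f‖₂ ≤ K ‖f‖₁`, `K² = (2m choose m)`, for `m`-homogeneous
polynomials `f` on the torus (`sqrt_sum_norm_sq_le`). Each monomial of `f²` arises from at most
`(2m choose m)` pairs of monomials, so Parseval's identity for `f²` gives `‖f‖₄² ≤ K ‖f‖₂²`, and
`‖f‖₂³ ≤ ‖f‖₁ ‖f‖₄²` gives the claim. Only orthogonality of monomials of degree at most `2m`
is used, so the torus can be replaced by the finite group of points whose coordinates are roots of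
unity of order `2m + 1`.

To bound `‖y‖` for `y = ∑ εₖ aₖ xₖ`, take a norming functional `φ` of `y` and let
`T : E → ℓ₂` be the diagonal operator `xₖ ↦ φ(xₖ) eₖ`.
* The inequality bounds `‖T v‖` by `K` times the average of `|φ(D_θ v)|` over `θ`, so
  `π₁(T) ≤ K` (`oneSummingNorm_diagonal_le`), and `γ₁(T) ≤ K gl(E)`.
* If `T = S R` is a factorization through `L₁(μ)`, then `‖y‖ = ∑ εₖ aₖ ⟨S R xₖ, eₖ⟩` is at most
  `‖S‖ ∫ (∑ |εₖ aₖ R xₖ|²)^{1/2} dμ`, because `S` acts as a functional on `L₁(μ; ℓ₂)`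
  (`norm_sum_apply_compLpL_le`). The inequality, applied pointwise, bounds the integral by `K` times
  the average of `‖R D_θ (∑ aₖ xₖ)‖`, hence by `K ‖R‖ ‖∑ aₖ xₖ‖`.
-/

/-! ### An `L₁`–`L₂` inequality for homogeneous polynomials on the discrete torus -/

section DiscreteTorus

variable {n : ℕ}

/-- The point of the torus `𝕋ⁿ` whose coordinates are the `q`-th roots of unity with exponents
`g`. As `g` runs through `(ℤ/q)ⁿ`, these points form a finite substitute for `𝕋ⁿ`. -/
noncomputable def torusPoint {q : ℕ} [NeZero q] (g : Fin n → ZMod q) : Fin n → ℂ :=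
  fun i => ZMod.stdAddChar (g i)

/-- The monomial `z^s`, where the multi-index is encoded as the multiset `s` of the variables that
occur, with multiplicity. -/
def multisetMonomial (s : Multiset (Fin n)) (z : Fin n → ℂ) : ℂ := (s.map z).prod

theorem multisetMonomial_eq_prod (s : Multiset (Fin n)) (z : Fin n → ℂ) :
    multisetMonomial s z = ∏ i, z i ^ s.count i := by
  rw [multisetMonomial, Finset.prod_multiset_map_count]
  exact Finset.prod_subset (Finset.subset_univ _) fun i _ hi => by
    rw [Multiset.count_eq_zero_of_notMem (by simpa using hi), pow_zero]

theorem multisetMonomial_add (s t : Multiset (Fin n)) (z : Fin n → ℂ) :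
    multisetMonomial (s + t) z = multisetMonomial s z * multisetMonomial t z := by
  simp [multisetMonomial]

theorem multisetMonomial_mul (s : Multiset (Fin n)) (θ z : Fin n → ℂ) :
    multisetMonomial s (fun i => θ i * z i) = multisetMonomial s θ * multisetMonomial s z :=
  Multiset.prod_map_mul

theorem norm_torusPoint {q : ℕ} [NeZero q] (g : Fin n → ZMod q) (i : Fin n) :
    ‖torusPoint g i‖ = 1 := AddChar.norm_apply _ _

theorem multisetMonomial_mul_conj {q : ℕ} [NeZero q] (g : Fin n → ZMod q)
    (s t : Multiset (Fin n)) :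
    multisetMonomial s (torusPoint g) * starRingEnd ℂ (multisetMonomial t (torusPoint g)) =
      ∏ i, ZMod.stdAddChar (g i * ((s.count i : ZMod q) - (t.count i : ZMod q))) := by
  rw [multisetMonomial_eq_prod, multisetMonomial_eq_prod, map_prod, ← Finset.prod_mul_distrib]
  refine Finset.prod_congr rfl fun i _ => ?_
  rw [map_pow, torusPoint, ← AddChar.map_neg_eq_conj, ← AddChar.map_nsmul_eq_pow,
    ← AddChar.map_nsmul_eq_pow, ← AddChar.map_add_eq_mul]
  congr 1
  simp only [nsmul_eq_mul]
  ring

/-- Orthogonality of the monomials whose exponents are smaller than `q`. -/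
theorem sum_multisetMonomial_mul_conj {q : ℕ} [NeZero q] {s t : Multiset (Fin n)}
    (hs : s.card < q) (ht : t.card < q) :
    ∑ g : Fin n → ZMod q, multisetMonomial s (torusPoint g) *
      starRingEnd ℂ (multisetMonomial t (torusPoint g)) = if s = t then (q : ℂ) ^ n else 0 := by
  simp_rw [multisetMonomial_mul_conj]
  rw [← Fintype.prod_sum (fun i (x : ZMod q) =>
    ZMod.stdAddChar (x * ((s.count i : ZMod q) - (t.count i : ZMod q))))]
  simp_rw [AddChar.sum_mulShift _ (ZMod.isPrimitive_stdAddChar q)]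
  have hiff : ∀ i, ((s.count i : ZMod q) - (t.count i : ZMod q) = 0) ↔ s.count i = t.count i := by
    intro i
    rw [sub_eq_zero, ZMod.natCast_eq_natCast_iff', Nat.mod_eq_of_lt, Nat.mod_eq_of_lt]
    · exact (Multiset.count_le_card i t).trans_lt ht
    · exact (Multiset.count_le_card i s).trans_lt hs
  split_ifs with h
  · subst h
    simp
  · obtain ⟨i, hi⟩ : ∃ i, s.count i ≠ t.count i := by
      by_contra! hcon
      exact h (Multiset.ext.mpr hcon)
    exact Finset.prod_eq_zero (Finset.mem_univ i) (by simp [hiff, hi])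

/-- Parseval's identity on the discrete torus. -/
theorem sum_norm_sq_torus {q : ℕ} [NeZero q] {κ : Type*} (S : Finset κ)
    {w : κ → Multiset (Fin n)} (hw : Set.InjOn w S) (hcard : ∀ k ∈ S, (w k).card < q)
    (c : κ → ℂ) :
    ∑ g : Fin n → ZMod q, ‖∑ k ∈ S, c k * multisetMonomial (w k) (torusPoint g)‖ ^ 2 =
      (q : ℝ) ^ n * ∑ k ∈ S, ‖c k‖ ^ 2 := by
  classical
  apply Complex.ofReal_injective
  push_cast
  simp_rw [← Complex.mul_conj', map_sum, map_mul, Finset.sum_mul_sum]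
  rw [Finset.sum_comm, Finset.mul_sum]
  refine Finset.sum_congr rfl fun k hk => ?_
  rw [Finset.sum_comm, Finset.sum_eq_single_of_mem k hk]
  · have := sum_multisetMonomial_mul_conj (hcard k hk) (hcard k hk)
    rw [if_pos rfl] at this
    rw [← this, Finset.sum_mul]
    exact Finset.sum_congr rfl fun g _ => by ring
  · intro l hl hlk
    have := sum_multisetMonomial_mul_conj (hcard k hk) (hcard l hl)
    rw [if_neg fun h => hlk (hw hk hl h).symm] at this
    rw [← mul_zero (c k * starRingEnd ℂ (c l)), ← this, Finset.mul_sum]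
    exact Finset.sum_congr rfl fun g _ => by ring

/-- A monomial `z^s` is a product of two monomials of degree `m` in at most `(|s| choose m)`
ways. -/
theorem card_filter_add_eq_le {I : Type*} [Fintype I] [DecidableEq I] {m : ℕ}
    {w : I → Multiset (Fin n)} (hw : Function.Injective w) (hcard : ∀ k, (w k).card = m)
    (s : Multiset (Fin n)) :
    (Finset.univ.filter fun p : I × I => w p.1 + w p.2 = s).card ≤ s.card.choose m := by
  rw [← Multiset.card_powersetCard]
  refine le_trans ?_ (Multiset.toFinset_card_le _)
  refine Finset.card_le_card_of_injOn (fun p => w p.1) ?_ ?_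
  · intro p hp
    simp only [Finset.coe_filter, Finset.mem_univ, true_and, Set.mem_ofPred_eq] at hp
    simp [Multiset.mem_powersetCard, hcard, ← hp]
  · rintro ⟨a, b⟩ hp ⟨a', b'⟩ hp' h
    simp only [Finset.coe_filter, Finset.mem_univ, true_and, Set.mem_ofPred_eq] at hp hp' h
    have h1 := hw h
    subst h1
    rw [← hp'] at hp
    rw [hw (add_left_cancel hp)]

/-- The fourth moment of an `m`-homogeneous polynomial `f`: Parseval's identity for `f²` and the
Cauchy–Schwarz inequality in each of its coefficients. -/
theorem sum_norm_pow_four_torus_le {I : Type*} [Fintype I] {m : ℕ}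
    {w : I → Multiset (Fin n)} (hw : Function.Injective w) (hcard : ∀ k, (w k).card = m)
    (c : I → ℂ) :
    ∑ g : Fin n → ZMod (2 * m + 1), ‖∑ k, c k * multisetMonomial (w k) (torusPoint g)‖ ^ 4 ≤
      ((2 * m + 1 : ℕ) : ℝ) ^ n * ((2 * m).choose m * (∑ k, ‖c k‖ ^ 2) ^ 2) := by
  classical
  set v : I × I → Multiset (Fin n) := fun p => w p.1 + w p.2
  set Γ : Finset (Multiset (Fin n)) := Finset.univ.image v
  have hmem : ∀ p ∈ (Finset.univ : Finset (I × I)), v p ∈ Γ := fun p hp =>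
    Finset.mem_image_of_mem v hp
  have hΓ : ∀ s ∈ Γ, s.card = 2 * m := by
    intro s hs
    obtain ⟨p, -, rfl⟩ := Finset.mem_image.mp hs
    simp [v, hcard]
    ring
  set d : Multiset (Fin n) → ℂ := fun s => ∑ p with v p = s, c p.1 * c p.2
  have hsq : ∀ z : Fin n → ℂ, (∑ k, c k * multisetMonomial (w k) z) ^ 2 =
      ∑ s ∈ Γ, d s * multisetMonomial s z := by
    intro z
    rw [sq, Fintype.sum_mul_sum, ← Fintype.sum_prod_type', ← Finset.sum_fiberwise_of_maps_to hmem]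
    refine Finset.sum_congr rfl fun s _ => ?_
    rw [Finset.sum_mul]
    refine Finset.sum_congr rfl fun p hp => ?_
    rw [← (Finset.mem_filter.mp hp).2, multisetMonomial_add]
    ring
  have hL : ∀ z : Fin n → ℂ, ‖∑ k, c k * multisetMonomial (w k) z‖ ^ 4 =
      ‖∑ s ∈ Γ, d s * multisetMonomial s z‖ ^ 2 := by
    intro z
    rw [← hsq, norm_pow]
    ring
  simp_rw [hL]
  have hP := sum_norm_sq_torus (q := 2 * m + 1) Γ (w := id) Function.injective_id.injOn
    (fun s hs => by rw [id, hΓ s hs]; omega) d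
  simp only [id] at hP
  rw [hP]
  gcongr
  calc ∑ s ∈ Γ, ‖d s‖ ^ 2
      ≤ ∑ s ∈ Γ, (2 * m).choose m * ∑ p with v p = s, ‖c p.1‖ ^ 2 * ‖c p.2‖ ^ 2 := by
        refine Finset.sum_le_sum fun s hs => ?_
        have h1 : ‖d s‖ ^ 2 ≤ (∑ p with v p = s, ‖c p.1‖ * ‖c p.2‖) ^ 2 := by
          gcongr
          exact (norm_sum_le _ _).trans_eq (by simp_rw [norm_mul])
        refine h1.trans (sq_sum_le_card_mul_sum_sq.trans ?_)
        simp_rw [mul_pow]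
        gcongr
        rw [← hΓ s hs]
        exact card_filter_add_eq_le hw hcard s
    _ = (2 * m).choose m * (∑ k, ‖c k‖ ^ 2) ^ 2 := by
        rw [← Finset.mul_sum, Finset.sum_fiberwise_of_maps_to hmem, sq, Fintype.sum_mul_sum,
          ← Fintype.sum_prod_type']

/-- The `L₂`-norm lies between the `L₁`-norm and the `L₄`-norm (the logarithmically convex
case of Hölder's inequality, without roots). -/
theorem sum_sq_pow_three_le {κ : Type*} (S : Finset κ) (f : κ → ℝ) (hf : ∀ k, 0 ≤ f k) :
    (∑ k ∈ S, f k ^ 2) ^ 3 ≤ (∑ k ∈ S, f k) ^ 2 * ∑ k ∈ S, f k ^ 4 := by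
  have h13 : (∑ k ∈ S, f k ^ 2) ^ 2 ≤ (∑ k ∈ S, f k) * ∑ k ∈ S, f k ^ 3 :=
    Finset.sum_sq_le_sum_mul_sum_of_sq_le_mul S (fun k _ => hf k)
      (fun k _ => pow_nonneg (hf k) 3) fun k _ => (by ring : _ = _).le
  have h24 : (∑ k ∈ S, f k ^ 3) ^ 2 ≤ (∑ k ∈ S, f k ^ 2) * ∑ k ∈ S, f k ^ 4 :=
    Finset.sum_sq_le_sum_mul_sum_of_sq_le_mul S (fun k _ => pow_nonneg (hf k) 2)
      (fun k _ => pow_nonneg (hf k) 4) fun k _ => (by ring : _ = _).le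
  have h1 : 0 ≤ ∑ k ∈ S, f k := Finset.sum_nonneg fun k _ => hf k
  have h2 : 0 ≤ ∑ k ∈ S, f k ^ 2 := Finset.sum_nonneg fun k _ => pow_nonneg (hf k) 2
  have h4 : 0 ≤ ∑ k ∈ S, f k ^ 4 := Finset.sum_nonneg fun k _ => pow_nonneg (hf k) 4
  rcases h2.eq_or_lt with h0 | h0
  · rw [← h0, zero_pow three_ne_zero]
    exact mul_nonneg (sq_nonneg _) h4
  refine le_of_mul_le_mul_left ?_ h0
  calc (∑ k ∈ S, f k ^ 2) * (∑ k ∈ S, f k ^ 2) ^ 3 = ((∑ k ∈ S, f k ^ 2) ^ 2) ^ 2 := by ring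
    _ ≤ ((∑ k ∈ S, f k) * ∑ k ∈ S, f k ^ 3) ^ 2 := by gcongr
    _ = (∑ k ∈ S, f k) ^ 2 * (∑ k ∈ S, f k ^ 3) ^ 2 := by ring
    _ ≤ (∑ k ∈ S, f k) ^ 2 * ((∑ k ∈ S, f k ^ 2) * ∑ k ∈ S, f k ^ 4) := by gcongr
    _ = _ := by ring

/-- For an `m`-homogeneous polynomial the `L₂`-norm on the torus is at most
`(2m choose m)^{1/2}` times the `L₁`-norm. -/
theorem sqrt_sum_norm_sq_le {I : Type*} [Fintype I] {m : ℕ}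
    {w : I → Multiset (Fin n)} (hw : Function.Injective w) (hcard : ∀ k, (w k).card = m)
    (c : I → ℂ) :
    √(∑ k, ‖c k‖ ^ 2) ≤ √((2 * m).choose m) * ((((2 * m + 1 : ℕ) : ℝ) ^ n)⁻¹ *
      ∑ g : Fin n → ZMod (2 * m + 1), ‖∑ k, c k * multisetMonomial (w k) (torusPoint g)‖) := by
  set Q : ℝ := ((2 * m + 1 : ℕ) : ℝ) ^ n
  have hQ : 0 < Q := by positivity
  set f : (Fin n → ZMod (2 * m + 1)) → ℝ := fun g =>
    ‖∑ k, c k * multisetMonomial (w k) (torusPoint g)‖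
  have hf : ∀ g, 0 ≤ f g := fun g => norm_nonneg _
  have h2 : ∑ g, f g ^ 2 = Q * ∑ k, ‖c k‖ ^ 2 :=
    sum_norm_sq_torus Finset.univ hw.injOn (fun k _ => by rw [hcard]; omega) c
  have h4 : ∑ g, f g ^ 4 ≤ Q * ((2 * m).choose m * (∑ k, ‖c k‖ ^ 2) ^ 2) :=
    sum_norm_pow_four_torus_le hw hcard c
  have h3 := sum_sq_pow_three_le Finset.univ f hf
  set N : ℝ := ∑ k, ‖c k‖ ^ 2
  set B : ℝ := (((2 * m).choose m : ℕ) : ℝ)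
  have hN : 0 ≤ N := Finset.sum_nonneg fun k _ => by positivity
  have hB : 0 ≤ B := Nat.cast_nonneg _
  have hsum : 0 ≤ ∑ g, f g := Finset.sum_nonneg fun g _ => hf g
  rw [← Real.sqrt_sq (mul_nonneg (inv_nonneg.mpr hQ.le) hsum), ← Real.sqrt_mul hB]
  refine Real.sqrt_le_sqrt ?_
  rcases hN.eq_or_lt with h0 | h0
  · rw [← h0]
    positivity
  rw [h2] at h3
  have h5 : (Q * N ^ 2) * (Q ^ 2 * N) ≤ (Q * N ^ 2) * (B * (∑ g, f g) ^ 2) :=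
    calc (Q * N ^ 2) * (Q ^ 2 * N) = (Q * N) ^ 3 := by ring
      _ ≤ (∑ g, f g) ^ 2 * ∑ g, f g ^ 4 := h3
      _ ≤ (∑ g, f g) ^ 2 * (Q * (B * N ^ 2)) := by gcongr
      _ = _ := by ring
  have h6 := le_of_mul_le_mul_left h5 (by positivity)
  rw [mul_pow, inv_pow, mul_left_comm, ← div_eq_inv_mul, le_div_iff₀ (by positivity)]
  linarith

end DiscreteTorus

/-! ### Operators from `L₁` into `ℓ₂` -/

section TraceOnLOne

open MeasureTheory

variable {Ω : Type*} [MeasurableSpace Ω] {μ : Measure Ω}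

theorem norm_toLp_add_of_disjoint_support {G : Type*} [NormedAddCommGroup G] {f g : Ω → G}
    (hf : MemLp f 1 μ) (hg : MemLp g 1 μ)
    (h : Disjoint (Function.support f) (Function.support g)) :
    ‖hf.toLp f + hg.toLp g‖ = ‖hf.toLp f‖ + ‖hg.toLp g‖ := by
  rw [← MemLp.toLp_add, L1.norm_eq_integral_norm, L1.norm_eq_integral_norm,
    L1.norm_eq_integral_norm, ← integral_add (L1.integrable_coeFn _).norm
      (L1.integrable_coeFn _).norm]
  refine integral_congr_ae ?_
  filter_upwards [hf.coeFn_toLp, hg.coeFn_toLp, (hf.add hg).coeFn_toLp] with t h1 h2 h3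
  rw [h1, h2, h3, Pi.add_apply]
  by_cases hft : f t = 0
  · simp [hft]
  · have : g t = 0 := by
      by_contra hgt
      exact Set.disjoint_left.mp h hft hgt
    simp [this]

/-- A bounded operator `S : L₁(μ) → ℓ₂` induces a functional of norm at most `‖S‖` on
`L₁(μ; ℓ₂ᴵ)`. It suffices to consider step functions, since the norm of `L₁` is additive on
functions with disjoint supports. -/
theorem norm_sum_apply_compLpL_le {I : Type*} [Fintype I] {e : I → ℕ}
    (he : Function.Injective e) (S : Lp ℂ 1 μ →L[ℂ] EllTwo)
    (F : Lp (EuclideanSpace ℂ I) 1 μ) :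
    ‖∑ k, S ((EuclideanSpace.proj k : EuclideanSpace ℂ I →L[ℂ] ℂ).compLpL 1 μ F) (e k)‖ ≤
      ‖S‖ * ‖F‖ := by
  induction F using Lp.induction ENNReal.one_ne_top with
  | indicatorConst c hs hμs =>
    rename_i s
    rw [Lp.simpleFunc.coe_indicatorConst]
    set u : EllTwo := S (indicatorConstLp 1 hs hμs.ne (1 : ℂ))
    have hproj : ∀ k, (EuclideanSpace.proj k : EuclideanSpace ℂ I →L[ℂ] ℂ).compLpL 1 μ
        (indicatorConstLp 1 hs hμs.ne c) = c k • indicatorConstLp 1 hs hμs.ne (1 : ℂ) := by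
      intro k
      ext1
      filter_upwards [ContinuousLinearMap.coeFn_compLpL
        (EuclideanSpace.proj k : EuclideanSpace ℂ I →L[ℂ] ℂ) (indicatorConstLp 1 hs hμs.ne c),
        indicatorConstLp_coeFn (p := 1) (hs := hs) (hμs := hμs.ne) (c := c),
        indicatorConstLp_coeFn (p := 1) (hs := hs) (hμs := hμs.ne) (c := (1 : ℂ)),
        Lp.coeFn_smul (c k) (indicatorConstLp 1 hs hμs.ne (1 : ℂ))] with t h1 h2 h3 h4
      rw [h1, h2, h4, Pi.smul_apply, h3]
      by_cases ht : t ∈ s <;> simp [ht]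
    have hterm : ∀ k, S ((EuclideanSpace.proj k : EuclideanSpace ℂ I →L[ℂ] ℂ).compLpL 1 μ
        (indicatorConstLp 1 hs hμs.ne c)) (e k) = c k * u (e k) := by
      intro k
      rw [hproj, map_smul]
      rfl
    simp_rw [hterm]
    have hu : ∑ k, ‖u (e k)‖ ^ 2 ≤ ‖u‖ ^ 2 := by
      have := lp.sum_rpow_le_norm_rpow (p := 2) (by simp) u (Finset.univ.map ⟨e, he⟩)
      rw [Finset.sum_map] at this
      simpa using this
    have hsq : (∑ k, ‖c k‖ * ‖u (e k)‖) ^ 2 ≤ (‖c‖ * ‖u‖) ^ 2 := by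
      rw [mul_pow, EuclideanSpace.norm_sq_eq]
      exact (Finset.sum_mul_sq_le_sq_mul_sq _ _ _).trans (by gcongr)
    calc ‖∑ k, c k * u (e k)‖ ≤ ∑ k, ‖c k‖ * ‖u (e k)‖ :=
          (norm_sum_le _ _).trans_eq (by simp_rw [norm_mul])
      _ ≤ ‖c‖ * ‖u‖ := le_of_sq_le_sq hsq (by positivity)
      _ ≤ ‖c‖ * (‖S‖ * ‖indicatorConstLp 1 hs hμs.ne (1 : ℂ)‖) := by
          gcongr
          exact S.le_opNorm _
      _ = ‖S‖ * ‖indicatorConstLp 1 hs hμs.ne c‖ := by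
          rw [norm_indicatorConstLp one_ne_zero ENNReal.one_ne_top,
            norm_indicatorConstLp one_ne_zero ENNReal.one_ne_top, norm_one]
          ring
  | add hf hg hd hf' hg' =>
    rw [norm_toLp_add_of_disjoint_support hf hg hd, mul_add]
    simp only [map_add, lp.coeFn_add, Pi.add_apply, Finset.sum_add_distrib]
    exact (norm_add_le _ _).trans (add_le_add hf' hg')
  | isClosed =>
    refine isClosed_le (continuous_norm.comp (continuous_finsetSum _ fun k _ => ?_))
      (continuous_const.mul continuous_norm)
    exact (lp.evalCLM ℂ (fun _ : ℕ => ℂ) 2 (e k)).continuous.comp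
      (S.continuous.comp (ContinuousLinearMap.continuous _))

/-- If a square function is dominated pointwise by the average of finitely many moduli, then the
trace of an operator `S : L₁(μ) → ℓ₂` against it is dominated by the average of the
`L₁`-norms. -/
theorem norm_sum_mul_apply_le_of_sqrt_sum_sq_le {I G : Type*} [Fintype I] [Fintype G]
    {e : I → ℕ} (he : Function.Injective e) (S : Lp ℂ 1 μ →L[ℂ] EllTwo) (h : I → Lp ℂ 1 μ)
    (ε : I → ℂ) (χ : I → G → ℂ) {K : ℝ}
    (hK : ∀ c : I → ℂ, √(∑ k, ‖c k * ε k‖ ^ 2) ≤ K * ∑ g, ‖∑ k, χ k g * c k‖) :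
    ‖∑ k, ε k * S (h k) (e k)‖ ≤ ‖S‖ * (K * ∑ g, ‖∑ k, χ k g • h k‖) := by
  classical
  -- the `ℓ₂ᴵ`-valued function with coordinates `εₖ hₖ`
  set single : I → ℂ →L[ℂ] EuclideanSpace ℂ I := fun k =>
    ContinuousLinearMap.toSpanSingleton ℂ (EuclideanSpace.single k (ε k))
  set F : Lp (EuclideanSpace ℂ I) 1 μ := ∑ k, (single k).compLpL 1 μ (h k)
  have hF : ∀ᵐ t ∂μ, ∀ k, F t k = h k t * ε k := by
    have h1 : ∀ᵐ t ∂μ, ∀ k, (single k).compLpL 1 μ (h k) t = single k (h k t) :=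
      ae_all_iff.mpr fun k => ContinuousLinearMap.coeFn_compLpL _ _
    filter_upwards [h1, Lp.coeFn_finsetSum Finset.univ
      fun k => (single k).compLpL 1 μ (h k)] with t ht hs k
    rw [hs, Finset.sum_apply]
    simp [ht, single, Finset.sum_apply, Pi.single_apply]
  have hproj : ∀ k,
      (EuclideanSpace.proj k : EuclideanSpace ℂ I →L[ℂ] ℂ).compLpL 1 μ F = ε k • h k := by
    intro k
    ext1
    filter_upwards [hF, ContinuousLinearMap.coeFn_compLpL
      (EuclideanSpace.proj k : EuclideanSpace ℂ I →L[ℂ] ℂ) F, Lp.coeFn_smul (ε k) (h k)]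
      with t h1 h2 h3
    rw [h2, h3, Pi.smul_apply, smul_eq_mul, mul_comm, ← h1]
    rfl
  have hmain := norm_sum_apply_compLpL_le he S F
  simp_rw [hproj, map_smul] at hmain
  refine hmain.trans (mul_le_mul_of_nonneg_left ?_ (norm_nonneg S))
  simp_rw [L1.norm_eq_integral_norm]
  rw [← integral_finsetSum _ fun g _ => (L1.integrable_coeFn _).norm, ← integral_const_mul]
  refine integral_mono_ae (L1.integrable_coeFn _).norm
    ((integrable_finsetSum _ fun g _ => (L1.integrable_coeFn _).norm).const_mul K) ?_
  have h2 : ∀ᵐ t ∂μ, ∀ g, (∑ k, χ k g • h k : Lp ℂ 1 μ) t = ∑ k, χ k g * h k t := by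
    refine ae_all_iff.mpr fun g => ?_
    have h3 : ∀ᵐ t ∂μ, ∀ k, (χ k g • h k : Lp ℂ 1 μ) t = χ k g * h k t :=
      ae_all_iff.mpr fun k => Lp.coeFn_smul _ _
    filter_upwards [h3, Lp.coeFn_finsetSum Finset.univ fun k => χ k g • h k] with t ht hs
    rw [hs, Finset.sum_apply]
    exact Finset.sum_congr rfl fun k _ => ht k
  filter_upwards [hF, h2] with t h1 h2
  rw [EuclideanSpace.norm_eq]
  simp_rw [h1, h2]
  exact hK _

end TraceOnLOne

/-! ### Bases with a torus of diagonal symmetries -/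

section DiagonalSymmetries

universe u

variable {E : Type u} [NormedAddCommGroup E] [NormedSpace ℂ E]

/-- Functionals of norm at most one have `1`-summing norm at most one. -/
theorem sum_norm_apply_le_one {k : ℕ} {x : Fin k → E}
    (hx : ∀ l : Fin k → ℂ, (∀ i, ‖l i‖ ≤ 1) → ‖∑ i, l i • x i‖ ≤ 1) (ψ : E →ₗ[ℂ] ℂ)
    (hψ : ∀ v, ‖ψ v‖ ≤ ‖v‖) : ∑ i, ‖ψ (x i)‖ ≤ 1 := by
  set l : Fin k → ℂ := fun i => starRingEnd ℂ (ψ (x i)) / ‖ψ (x i)‖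
  have hl : ∀ i, ‖l i‖ ≤ 1 := fun i => by
    simp only [l, norm_div, RCLike.norm_conj, Complex.norm_real, norm_norm]
    exact div_self_le_one _
  have hli : ∀ i, l i * ψ (x i) = ‖ψ (x i)‖ := fun i => by
    by_cases h : ‖ψ (x i)‖ = 0
    · simp [l, h]
    · have : (‖ψ (x i)‖ : ℂ) ≠ 0 := by exact_mod_cast h
      rw [div_mul_eq_mul_div, Complex.conj_mul', sq, mul_div_assoc, div_self this, mul_one]
  have h1 : ψ (∑ i, l i • x i) = ((∑ i, ‖ψ (x i)‖ : ℝ) : ℂ) := by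
    simp [map_sum, hli]
  calc ∑ i, ‖ψ (x i)‖ = ‖ψ (∑ i, l i • x i)‖ := by
        rw [h1, Complex.norm_real, Real.norm_of_nonneg]
        exact Finset.sum_nonneg fun _ _ => norm_nonneg _
    _ ≤ 1 := (hψ _).trans (hx l hl)

/-- The diagonal operator `∑ aₖ xₖ ↦ (dₖ aₖ)ₖ` into `ℓ₂`, where the `k`-th coordinate is put in
position `e k`. -/
theorem exists_diagonal_ellTwo {I : Type*} [Fintype I] (b : Module.Basis I ℂ E) (d : I → ℂ)
    {e : I → ℕ} (he : Function.Injective e) :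
    ∃ T : E →L[ℂ] EllTwo, (∀ v k, T v (e k) = d k * b.repr v k) ∧
      ∀ v, ‖T v‖ = √(∑ k, ‖d k * b.repr v k‖ ^ 2) := by
  classical
  have : FiniteDimensional ℂ E := Module.Finite.of_basis b
  have hval : ∀ v k, (∑ l, lp.single 2 (e l) (d l * b.repr v l) : EllTwo) (e k) =
      d k * b.repr v k := by
    intro v k
    rw [lp.coeFn_sum, Finset.sum_apply, Finset.sum_eq_single k]
    · exact lp.single_apply_self _ _ _
    · intro l _ hl
      exact lp.single_apply_ne _ _ _ fun h => hl (he h).symm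
    · simp
  refine ⟨LinearMap.toContinuousLinearMap
    { toFun := fun v => ∑ l, lp.single 2 (e l) (d l * b.repr v l)
      map_add' := fun v w => by simp [mul_add, Finset.sum_add_distrib, lp.single_add]
      map_smul' := fun r v => by
        simp [Finset.smul_sum, ← lp.single_smul, mul_left_comm] }, hval, fun v => ?_⟩
  have h1 := lp.norm_sum_single (E := fun _ : ℕ => ℂ) (p := 2) (by simp)
    (Function.extend e (fun l => d l * b.repr v l) 0) (Finset.univ.map ⟨e, he⟩)
  simp only [Finset.sum_map, Function.Embedding.coeFn_mk, he.extend_apply, ENNReal.toReal_ofNat,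
    Real.rpow_ofNat] at h1
  rw [← h1, Real.sqrt_sq (norm_nonneg _)]
  rfl

/-- If `θ ↦ (xₖ ↦ θ^{wₖ} xₖ)` acts by contractions, for distinct multi-indices `wₖ` of order `m`,
then diagonal operators given by a functional of norm at most one have `1`-summing norm at most
`(2m choose m)^{1/2}`. -/
theorem oneSummingNorm_diagonal_le {n m : ℕ} {I : Type*} [Fintype I] (b : Module.Basis I ℂ E)
    {w : I → Multiset (Fin n)} (hw : Function.Injective w) (hcard : ∀ k, (w k).card = m)
    (hb : ∀ (g : Fin n → ZMod (2 * m + 1)) (a : I → ℂ),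
      ‖∑ k, (multisetMonomial (w k) (torusPoint g) * a k) • b k‖ ≤ ‖∑ k, a k • b k‖)
    (φ : StrongDual ℂ E) (hφ : ‖φ‖ ≤ 1) (T : E →L[ℂ] EllTwo)
    (hT : ∀ v, ‖T v‖ = √(∑ k, ‖φ (b k) * b.repr v k‖ ^ 2)) :
    oneSummingNorm T ≤ ENNReal.ofReal √((2 * m).choose m) := by
  refine iSup_le fun N => iSup_le fun x => iSup_le fun hx => ?_
  set Q : ℝ := ((2 * m + 1 : ℕ) : ℝ) ^ n
  have hQ : 0 < Q := by positivity
  -- the functionals `φ ∘ D_θ`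
  let ψ : (Fin n → ZMod (2 * m + 1)) → E →ₗ[ℂ] ℂ := fun g =>
    ∑ k, (φ (b k) * multisetMonomial (w k) (torusPoint g)) • b.coord k
  have hψ_apply : ∀ g v, ψ g v =
      ∑ k, φ (b k) * b.repr v k * multisetMonomial (w k) (torusPoint g) := by
    intro g v
    simp only [ψ, LinearMap.sum_apply, LinearMap.smul_apply, Module.Basis.coord_apply,
      smul_eq_mul]
    exact Finset.sum_congr rfl fun k _ => by ring
  have hψ : ∀ g v, ‖ψ g v‖ ≤ ‖v‖ := by
    intro g v
    have h1 : ψ g v = φ (∑ k, (multisetMonomial (w k) (torusPoint g) * b.repr v k) • b k) := by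
      rw [hψ_apply, map_sum]
      exact Finset.sum_congr rfl fun k _ => by rw [map_smul, smul_eq_mul]; ring
    rw [h1]
    calc _ ≤ 1 * ‖∑ k, (multisetMonomial (w k) (torusPoint g) * b.repr v k) • b k‖ :=
          φ.le_of_opNorm_le hφ _
      _ ≤ ‖v‖ := by
          rw [one_mul]
          exact (hb g fun k => b.repr v k).trans_eq (by rw [b.sum_repr])
  have hTx : ∀ i, ‖T (x i)‖ ≤ √((2 * m).choose m) * (Q⁻¹ * ∑ g, ‖ψ g (x i)‖) := by
    intro i
    rw [hT]
    simp_rw [hψ_apply]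
    exact sqrt_sum_norm_sq_le hw hcard _
  simp_rw [← ofReal_norm]
  rw [← ENNReal.ofReal_sum_of_nonneg fun _ _ => norm_nonneg _]
  refine ENNReal.ofReal_le_ofReal ?_
  calc ∑ i, ‖T (x i)‖ ≤ ∑ i, √((2 * m).choose m) * (Q⁻¹ * ∑ g, ‖ψ g (x i)‖) :=
        Finset.sum_le_sum fun i _ => hTx i
    _ = √((2 * m).choose m) * (Q⁻¹ * ∑ g, ∑ i, ‖ψ g (x i)‖) := by
        rw [← Finset.mul_sum, ← Finset.mul_sum, Finset.sum_comm]
    _ ≤ √((2 * m).choose m) * (Q⁻¹ * ∑ _g : Fin n → ZMod (2 * m + 1), 1) := by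
        gcongr
        exact sum_norm_apply_le_one hx _ (hψ _)
    _ = √((2 * m).choose m) := by
        have : ∑ _g : Fin n → ZMod (2 * m + 1), (1 : ℝ) = Q := by simp [Q]
        rw [this, inv_mul_cancel₀ hQ.ne', mul_one]

/-- The trace of `S R` against a diagonal operator with coefficients `εₖ aₖ`. The `εₖ` disappear in
the square function `(∑ |εₖ aₖ R xₖ|²)^{1/2}`, before the `L₁`–`L₂` inequality is applied. -/
theorem norm_sum_mul_le_of_factorization {n m : ℕ} {I : Type*} [Fintype I] {x : I → E}
    {w : I → Multiset (Fin n)} (hw : Function.Injective w) (hcard : ∀ k, (w k).card = m)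
    (hx : ∀ (g : Fin n → ZMod (2 * m + 1)) (a : I → ℂ),
      ‖∑ k, (multisetMonomial (w k) (torusPoint g) * a k) • x k‖ ≤ ‖∑ k, a k • x k‖)
    {Ω : Type*} [MeasurableSpace Ω] {μ : MeasureTheory.Measure Ω}
    (R : E →L[ℂ] MeasureTheory.Lp ℂ 1 μ) (S : MeasureTheory.Lp ℂ 1 μ →L[ℂ] EllTwo)
    {e : I → ℕ} (he : Function.Injective e) {ε a : I → ℂ} (hε : ∀ k, ‖ε k‖ ≤ 1) :
    ‖∑ k, (ε k * a k) * S (R (x k)) (e k)‖ ≤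
      √((2 * m).choose m) * (‖R‖ * ‖S‖) * ‖∑ k, a k • x k‖ := by
  set Q : ℝ := ((2 * m + 1 : ℕ) : ℝ) ^ n
  have hQ : 0 < Q := by positivity
  have hK : ∀ c : I → ℂ, √(∑ k, ‖c k * ε k‖ ^ 2) ≤ √((2 * m).choose m) * Q⁻¹ *
      ∑ g : Fin n → ZMod (2 * m + 1), ‖∑ k, multisetMonomial (w k) (torusPoint g) * c k‖ := by
    intro c
    have h1 := sqrt_sum_norm_sq_le hw hcard c
    simp_rw [mul_comm (c _) (multisetMonomial _ _)] at h1
    rw [mul_assoc]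
    refine (Real.sqrt_le_sqrt (Finset.sum_le_sum fun k _ => ?_)).trans h1
    rw [norm_mul]
    gcongr
    exact mul_le_of_le_one_right (norm_nonneg _) (hε k)
  have hsmul : ∀ k, (ε k * a k) * S (R (x k)) (e k) = ε k * S (a k • R (x k)) (e k) := by
    intro k
    rw [map_smul, mul_assoc]
    rfl
  simp_rw [hsmul]
  refine (norm_sum_mul_apply_le_of_sqrt_sum_sq_le he S _ ε _ hK).trans ?_
  have hR : ∀ g : Fin n → ZMod (2 * m + 1),
      ‖∑ k, multisetMonomial (w k) (torusPoint g) • a k • R (x k)‖ ≤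
        ‖R‖ * ‖∑ k, a k • x k‖ := by
    intro g
    have h1 : ∑ k, multisetMonomial (w k) (torusPoint g) • a k • R (x k) =
        R (∑ k, (multisetMonomial (w k) (torusPoint g) * a k) • x k) := by
      simp only [map_sum, map_smul, smul_smul]
    rw [h1]
    exact (R.le_opNorm _).trans (by gcongr; exact hx g a)
  calc _ ≤ ‖S‖ * (√((2 * m).choose m) * Q⁻¹ *
        ∑ _g : Fin n → ZMod (2 * m + 1), ‖R‖ * ‖∑ k, a k • x k‖) := by
        gcongr with g
        exact hR g
    _ = √((2 * m).choose m) * (‖R‖ * ‖S‖) * ‖∑ k, a k • x k‖ * (Q⁻¹ * Q) := by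
        rw [Finset.sum_const, nsmul_eq_mul]
        have : ((Finset.univ : Finset (Fin n → ZMod (2 * m + 1))).card : ℝ) = Q := by simp [Q]
        rw [this]
        ring
    _ = _ := by rw [inv_mul_cancel₀ hQ.ne', mul_one]

/-- A basis with a torus of diagonal contractions of homogeneous degree `m`: the unconditional
basis constant is at most `(2m choose m)` times the Gordon–Lewis constant. -/
theorem unconditionalConstant_le_choose_mul_gordonLewis {n m : ℕ} {I : Type*} [Fintype I]
    (b : Module.Basis I ℂ E) {w : I → Multiset (Fin n)} (hw : Function.Injective w)
    (hcard : ∀ k, (w k).card = m)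
    (hb : ∀ (g : Fin n → ZMod (2 * m + 1)) (a : I → ℂ),
      ‖∑ k, (multisetMonomial (w k) (torusPoint g) * a k) • b k‖ ≤ ‖∑ k, a k • b k‖) :
    unconditionalConstant b ≤ ((2 * m).choose m : ℝ≥0∞) * gordonLewis E := by
  classical
  have hB0 : ((2 * m).choose m : ℝ≥0∞) ≠ 0 := by
    exact_mod_cast (Nat.choose_pos (by omega)).ne'
  have hBtop : ((2 * m).choose m : ℝ≥0∞) ≠ ∞ := ENNReal.natCast_ne_top _
  rw [gordonLewis, ENNReal.mul_iInf_of_ne hB0 hBtop]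
  refine le_iInf fun c => ?_
  rw [ENNReal.mul_iInf_of_ne hB0 hBtop]
  refine le_iInf fun hc => ?_
  suffices h : IsUnconditionalWith (((2 * m).choose m : ℝ≥0) * c) b by
    refine (iInf₂_le (f := fun (C : ℝ≥0) (_ : IsUnconditionalWith C b) =>
      (C : ℝ≥0∞)) _ h).trans_eq ?_
    push_cast
    rfl
  intro s ε a hε
  -- coefficients are extended by zero outside `s`
  set a' : I → ℂ := fun k => if k ∈ s then a k else 0
  have hsum : ∀ d : I → ℂ, ∑ k ∈ s, (d k * a k) • b k = ∑ k, (d k * a' k) • b k := by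
    intro d
    simp [a', ite_smul, Finset.sum_ite_mem]
  have hsum1 := hsum 1
  simp only [Pi.one_apply, one_mul] at hsum1
  rw [hsum, hsum1]
  set B : ℝ := (((2 * m).choose m : ℕ) : ℝ)
  have hB : 0 ≤ B := Nat.cast_nonneg _
  obtain ⟨φ, hφ, hφy⟩ := exists_dual_vector'' ℂ (∑ k, (ε k * a' k) • b k)
  set e : I → ℕ := fun k => (Fintype.equivFin I k : ℕ)
  have he : Function.Injective e := fun k l h =>
    (Fintype.equivFin I).injective (Fin.val_injective h)
  obtain ⟨T, hT, hTnorm⟩ := exists_diagonal_ellTwo b (fun k => φ (b k)) he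
  have hπ := oneSummingNorm_diagonal_le b hw hcard hb φ hφ T hTnorm
  have hγ : gammaOne T ≤ ENNReal.ofReal (c * √B) := by
    refine (hc T (hπ.trans_lt ENNReal.ofReal_lt_top).ne).trans ?_
    rw [ENNReal.ofReal_mul c.coe_nonneg, ENNReal.ofReal_coe_nnreal]
    gcongr
  refine le_of_forall_pos_le_add fun δ hδ => ?_
  set X : ℝ := ‖∑ k, a' k • b k‖
  have hpos : 0 < √B * X + 1 := by positivity
  set η : ℝ := δ / (√B * X + 1)
  have hη : 0 < η := div_pos hδ hpos
  have hlt : gammaOne T < ENNReal.ofReal (c * √B + η) :=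
    hγ.trans_lt ((ENNReal.ofReal_lt_ofReal_iff (by positivity)).mpr (by linarith))
  simp only [gammaOne, iInf_lt_iff] at hlt
  obtain ⟨Ω, hΩ, μ, R, S, hSR, hlt⟩ := hlt
  have hRS : ‖R‖ * ‖S‖ ≤ c * √B + η := by
    rw [← ofReal_norm, ← ofReal_norm, ← ENNReal.ofReal_mul (norm_nonneg R)] at hlt
    exact ((ENNReal.ofReal_lt_ofReal_iff (by positivity)).mp hlt).le
  have hdiag : ∀ k, S (R (b k)) (e k) = φ (b k) := by
    intro k
    have h1 : S (R (b k)) = T (b k) := by rw [← hSR]; rfl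
    rw [h1, hT]
    simp
  have htrace := norm_sum_mul_le_of_factorization hw hcard hb R S he (a := a') hε
  simp_rw [hdiag] at htrace
  have hy : ‖∑ k, (ε k * a' k) • b k‖ = ‖∑ k, ε k * a' k * φ (b k)‖ := by
    have h1 : ∑ k, ε k * a' k * φ (b k) = φ (∑ k, (ε k * a' k) • b k) := by
      simp only [map_sum, map_smul, smul_eq_mul]
    rw [h1, hφy]
    simp
  rw [hy]
  calc _ ≤ √B * (‖R‖ * ‖S‖) * X := htrace
    _ ≤ √B * (c * √B + η) * X := by gcongr
    _ = (√B * √B) * c * X + η * (√B * X) := by ring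
    _ ≤ B * c * X + δ := by
        rw [Real.mul_self_sqrt hB]
        gcongr
        rw [div_mul_eq_mul_div, div_le_iff₀ hpos]
        nlinarith
    _ = _ := by simp [B, X]

end DiagonalSymmetries

/-! ### Spaces of homogeneous polynomials -/

namespace CnNorm

variable {n : ℕ} (N : CnNorm n)

theorem sum_smul_unitVector (z : Fin n → ℂ) :
    N.coords (∑ k, z k • N.unitVector k) = z := by
  rw [map_sum]
  exact (pi_eq_sum_univ' z).symm

theorem norm_mul_le {N : CnNorm n} (hN : IsUnconditionalWith 1 N.unitVector) {θ : Fin n → ℂ}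
    (hθ : ∀ i, ‖θ i‖ ≤ 1) (z : N.Space) :
    ‖∑ k, (θ k * N.coords z k) • N.unitVector k‖ ≤ ‖z‖ := by
  have h := hN Finset.univ θ (N.coords z) hθ
  rwa [NNReal.coe_one, one_mul,
    show ∑ k, N.coords z k • N.unitVector k = z from N.sum_smul_unitVector _] at h

end CnNorm

namespace HomPoly

variable {n : ℕ} (N : CnNorm n) (m : ℕ)

theorem toMultiset_card {n m : ℕ} (β : {β : Fin n →₀ ℕ // β.degree = m}) :
    (Finsupp.toMultiset β.1).card = m := by
  rw [Finsupp.card_toMultiset, Finsupp.sum_fintype _ _ fun _ => rfl]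
  exact (Finsupp.degree_eq_sum β.1).symm.trans β.2

instance finite_multiIndex {n m : ℕ} : Finite {β : Fin n →₀ ℕ // β.degree = m} :=
  Finite.of_injective (β := Sym (Fin n) m)
    (fun β => ⟨Finsupp.toMultiset β.1, toMultiset_card β⟩)
    fun _ _ h => Subtype.ext (Multiset.toFinsupp.symm.injective (congrArg Subtype.val h))

theorem linearIndependent_monomial : LinearIndependent ℂ (monomial N m) := by
  refine LinearIndependent.of_comp (toMvPolynomial N m) ?_
  have h := (MvPolynomial.basisMonomials (Fin n) ℂ).linearIndependent
  rw [MvPolynomial.coe_basisMonomials] at h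
  exact h.comp _ Subtype.val_injective

theorem span_monomial : ⊤ ≤ Submodule.span ℂ (Set.range (monomial N m)) := by
  rintro p -
  have hp : (toMvPolynomial N m p).IsHomogeneous m := p.2
  have h : p = ∑ d ∈ (toMvPolynomial N m p).support.attach,
      (toMvPolynomial N m p).coeff d.1 • monomial N m ⟨d.1, by
        have := hp (MvPolynomial.mem_support_iff.mp d.2)
        rwa [Finsupp.degree_eq_weight_one]⟩ := by
    refine Subtype.ext ?_
    change toMvPolynomial N m p = toMvPolynomial N m _
    rw [map_sum]
    conv_lhs => rw [(toMvPolynomial N m p).as_sum]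
    rw [← Finset.sum_attach]
    refine Finset.sum_congr rfl fun d _ => ?_
    rw [map_smul]
    change _ = _ • MvPolynomial.monomial d.1 (1 : ℂ)
    rw [MvPolynomial.smul_monomial, smul_eq_mul, mul_one]
  rw [h]
  exact Submodule.sum_mem _ fun d _ =>
    Submodule.smul_mem _ _ (Submodule.subset_span ⟨_, rfl⟩)

/-- The monomials `z^β`, `|β| = m`, as a basis of the space of `m`-homogeneous polynomials. -/
noncomputable def monomialBasis :
    Module.Basis {β : Fin n →₀ ℕ // β.degree = m} ℂ (HomPoly N m) :=
  Module.Basis.mk (linearIndependent_monomial N m) (span_monomial N m)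

theorem coe_monomialBasis : ⇑(monomialBasis N m) = monomial N m := Module.Basis.coe_mk _ _

variable {N m}

theorem evalAt_sum_smul_monomial {I : Type*} (s : Finset I) (a : I → ℂ)
    (β : I → {β : Fin n →₀ ℕ // β.degree = m}) (z : N.Space) :
    evalAt (∑ k ∈ s, a k • monomial N m (β k)) z =
      ∑ k ∈ s, a k * multisetMonomial (Finsupp.toMultiset (β k).1) (N.coords z) := by
  simp only [evalAt, map_sum, map_smul, MvPolynomial.smul_eval]
  refine Finset.sum_congr rfl fun k _ => ?_
  change _ * MvPolynomial.eval _ (MvPolynomial.monomial (β k).1 (1 : ℂ)) = _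
  rw [multisetMonomial_eq_prod, MvPolynomial.eval_monomial, one_mul,
    Finsupp.prod_fintype _ _ fun _ => pow_zero _]
  simp_rw [Finsupp.count_toMultiset]

/-- On a space with `1`-unconditional unit vectors, `p ↦ p(θ ·)` is a contraction. -/
theorem norm_sum_torus_smul_monomial_le (hN : IsUnconditionalWith 1 N.unitVector)
    [Fintype {β : Fin n →₀ ℕ // β.degree = m}] {θ : Fin n → ℂ} (hθ : ∀ i, ‖θ i‖ ≤ 1)
    (a : {β : Fin n →₀ ℕ // β.degree = m} → ℂ) :
    ‖∑ β, (multisetMonomial (Finsupp.toMultiset β.1) θ * a β) • monomial N m β‖ ≤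
      ‖∑ β, a β • monomial N m β‖ := by
  have : Nonempty {z : N.Space // ‖z‖ ≤ 1} := ⟨⟨0, by simp⟩⟩
  rw [norm_def]
  refine ciSup_le fun z => ?_
  have h : evalAt (∑ β, (multisetMonomial (Finsupp.toMultiset β.1) θ * a β) • monomial N m β) z.1
      = evalAt (∑ β, a β • monomial N m β)
        (∑ k, (θ k * N.coords z.1 k) • N.unitVector k) := by
    have h1 := evalAt_sum_smul_monomial (N := N) (m := m) Finset.univ
      (fun β => multisetMonomial (Finsupp.toMultiset β.1) θ * a β) id z.1
    have h2 := evalAt_sum_smul_monomial (N := N) (m := m) Finset.univ a id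
      (∑ k, (θ k * N.coords z.1 k) • N.unitVector k)
    rw [N.sum_smul_unitVector] at h2
    simp only [id] at h1 h2
    rw [h1, h2]
    refine Finset.sum_congr rfl fun β _ => ?_
    rw [multisetMonomial_mul]
    ring
  rw [h]
  exact le_norm _ ((CnNorm.norm_mul_le hN hθ z.1).trans z.2)

theorem unconditionalConstant_monomial_le (hN : IsUnconditionalWith 1 N.unitVector) :
    unconditionalConstant (monomial N m) ≤
      ((2 * m).choose m : ℝ≥0∞) * gordonLewis (HomPoly N m) := by
  have : Fintype {β : Fin n →₀ ℕ // β.degree = m} := Fintype.ofFinite _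
  have h := unconditionalConstant_le_choose_mul_gordonLewis (n := n) (monomialBasis N m)
    (w := fun β => Finsupp.toMultiset β.1)
    (fun _ _ h => Subtype.ext (Multiset.toFinsupp.symm.injective h)) toMultiset_card
    (fun g a => by
      simp only [coe_monomialBasis]
      exact norm_sum_torus_smul_monomial_le hN (fun i => (norm_torusPoint g i).le) a)
  rwa [coe_monomialBasis] at h

end HomPoly

/-! ### Symmetric tensor powers -/

section MonotoneTuples

variable {n m : ℕ}

theorem card_map_univ (p : Fin m → Fin n) : (Multiset.map p Finset.univ.val).card = m := by
  simp

theorem eq_of_map_univ_eq {p p' : Fin m → Fin n} (hp : Monotone p) (hp' : Monotone p')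
    (h : Multiset.map p Finset.univ.val = Multiset.map p' Finset.univ.val) : p = p' := by
  rw [Fin.univ_val_map, Fin.univ_val_map, Multiset.coe_eq_coe] at h
  exact List.ofFn_injective (h.eq_of_sortedLE (List.sortedLE_ofFn_iff.mpr hp)
    (List.sortedLE_ofFn_iff.mpr hp'))

theorem multisetMonomial_map_univ (p : Fin m → Fin n) (θ : Fin n → ℂ) :
    multisetMonomial (Multiset.map p Finset.univ.val) θ = ∏ i, θ (p i) := by
  rw [multisetMonomial, Multiset.map_map]
  rfl

end MonotoneTuples

namespace SymTensorPower

universe u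

variable {m n : ℕ} {X : Type u} [NormedAddCommGroup X] [NormedSpace ℂ X] {α : SymTensorNorm}

theorem map_diagTensor (d : X →L[ℂ] X) {k : ℕ} (l : Fin k → ℂ) (x : Fin k → X) :
    PiTensorProduct.map (fun _ : Fin m => (d : X →ₗ[ℂ] X)) (∑ i, l i • diagTensor m (x i)) =
      ∑ i, l i • diagTensor m (d (x i)) := by
  rw [map_sum]
  refine Finset.sum_congr rfl fun i _ => ?_
  rw [map_smul, diagTensor, PiTensorProduct.map_tprod]
  rfl

/-- Both norms on symmetric tensors have the metric mapping property: `d ⊗ ⋯ ⊗ d` is a contraction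
if `d` is one. -/
theorem norm_le_of_toTensor_eq_map (d : X →L[ℂ] X) (hd : ∀ v, ‖d v‖ ≤ ‖v‖)
    {z z' : SymTensorPower m X α}
    (h : toTensor z' = PiTensorProduct.map (fun _ : Fin m => (d : X →ₗ[ℂ] X)) (toTensor z)) :
    ‖z'‖ ≤ ‖z‖ := by
  cases α with
  | projective =>
    change symProjNorm (toTensor z') ≤ symProjNorm (toTensor z)
    refine le_of_forall_pos_le_add fun δ hδ => ?_
    obtain ⟨k, l, x, hz, hlt⟩ := exists_rep_lt z hδ
    rw [hz, map_diagTensor] at h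
    refine ((symProjNorm_le l _ h).trans (Finset.sum_le_sum fun i _ => ?_)).trans hlt.le
    gcongr
    exact hd _
  | injective =>
    change symInjNorm (toTensor z') ≤ symInjNorm (toTensor z)
    have : Nonempty {φ : StrongDual ℂ X // ‖φ‖ ≤ 1} := ⟨⟨0, by simp⟩⟩
    refine ciSup_le fun φ => ?_
    have hφ : ‖φ.1.comp d‖ ≤ 1 := by
      refine ContinuousLinearMap.opNorm_le_bound _ zero_le_one fun v => ?_
      exact (φ.1.le_of_opNorm_le φ.2 _).trans (by gcongr; exact hd v)
    have hpair : powerPairing φ.1 (toTensor z') = powerPairing (φ.1.comp d) (toTensor z) := by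
      obtain ⟨k, l, x, hz⟩ := exists_rep z
      rw [h, hz, map_diagTensor, map_sum, map_sum]
      simp [powerPairing, diagTensor]
    rw [hpair]
    exact le_symInjNorm z hφ

theorem toTensor_sym (y : Fin m → X) :
    toTensor (sym α y) =
      (Nat.factorial m : ℂ)⁻¹ • ∑ σ : Equiv.Perm (Fin m), ⨂ₜ[ℂ] i, y (σ i) :=
  symmetrization_tprod m X y

theorem sym_comp_perm (y : Fin m → X) (τ : Equiv.Perm (Fin m)) :
    sym α (fun i => y (τ i)) = sym α y := by
  refine Subtype.ext ?_
  change toTensor (sym α fun i => y (τ i)) = toTensor (sym α y)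
  rw [toTensor_sym, toTensor_sym]
  congr 1
  exact Equiv.sum_comp (Equiv.mulLeft τ)
    fun σ : Equiv.Perm (Fin m) => ⨂ₜ[ℂ] i, y (σ i)

theorem linearIndependent_sym (x : Module.Basis (Fin n) ℂ X) :
    LinearIndependent ℂ fun j : {j : Fin m → Fin n // Monotone j} =>
      sym α fun i => x (j.1 i) := by
  classical
  refine Fintype.linearIndependent_iff.mpr fun c hc j₀ => ?_
  have h := congrArg (fun z => (Basis.piTensorProduct fun _ : Fin m => x).repr (toTensor z) j₀.1) hc
  simp only [map_sum, map_smul, toTensor_sym, map_zero, Finsupp.coe_finsetSum, Finsupp.coe_smul,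
    Finset.sum_apply, Pi.smul_apply, Basis.piTensorProduct_repr_tprod_apply,
    Module.Basis.repr_self, smul_eq_mul, Finsupp.coe_zero, Pi.zero_apply] at h
  have hprod : ∀ (j : {j : Fin m → Fin n // Monotone j}) (σ : Equiv.Perm (Fin m)),
      ∏ i, (Finsupp.single (j.1 (σ i)) (1 : ℂ)) (j₀.1 i) = if j.1 ∘ σ = j₀.1 then 1 else 0 := by
    intro j σ
    split_ifs with hj
    · exact Finset.prod_eq_one fun i _ => by rw [← hj]; simp
    · obtain ⟨i, hi⟩ := Function.ne_iff.mp hj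
      exact Finset.prod_eq_zero (Finset.mem_univ i) (Finsupp.single_eq_of_ne (Ne.symm hi))
  simp_rw [hprod] at h
  rw [Finset.sum_eq_single j₀] at h
  · refine (mul_eq_zero.mp h).resolve_right (mul_ne_zero ?_ ?_)
    · exact inv_ne_zero (by exact_mod_cast Nat.factorial_ne_zero m)
    · rw [Finset.sum_boole]
      exact_mod_cast (Finset.card_pos.mpr ⟨1, by simp⟩).ne'
  · intro j _ hj
    rw [Finset.sum_eq_zero, mul_zero, mul_zero]
    intro σ _
    refine if_neg fun hσ => hj (Subtype.ext ?_)
    exact Tuple.unique_monotone (f := j.1) (σ := 1) (τ := σ) j.2 (hσ ▸ j₀.2) |>.trans hσ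
  · simp

theorem span_sym (x : Module.Basis (Fin n) ℂ X) :
    ⊤ ≤ Submodule.span ℂ (Set.range fun j : {j : Fin m → Fin n // Monotone j} =>
      sym α fun i => x (j.1 i)) := by
  rintro ⟨_, t, rfl⟩ -
  let S : (⨂[ℂ] _ : Fin m, X) →ₗ[ℂ] SymTensorPower m X α := (symmetrization m X).rangeRestrict
  change S t ∈ _
  rw [← (Basis.piTensorProduct fun _ : Fin m => x).sum_repr t, map_sum]
  refine Submodule.sum_mem _ fun p _ => ?_
  rw [map_smul, Basis.piTensorProduct_apply]
  refine Submodule.smul_mem _ _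
    (Submodule.subset_span ⟨⟨p ∘ Tuple.sort p, Tuple.monotone_sort p⟩, ?_⟩)
  exact sym_comp_perm (fun i => x (p i)) (Tuple.sort p)

/-- The symmetrized tensors of basis vectors with increasing indices, as a basis. -/
noncomputable def symBasis (α : SymTensorNorm) (m : ℕ) (x : Module.Basis (Fin n) ℂ X) :
    Module.Basis {j : Fin m → Fin n // Monotone j} ℂ (SymTensorPower m X α) :=
  Module.Basis.mk (linearIndependent_sym x) (span_sym x)

theorem coe_symBasis (x : Module.Basis (Fin n) ℂ X) :
    ⇑(symBasis α m x) = fun j : {j : Fin m → Fin n // Monotone j} =>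
      sym α fun i => x (j.1 i) := Module.Basis.coe_mk _ _

/-- The diagonal map of the symmetric tensor power with multipliers `θ_{j₁} ⋯ θ_{jₘ}` is a
contraction, being induced by the diagonal map of `X` with multipliers `θ`. -/
theorem norm_sum_torus_smul_sym_le {x : Module.Basis (Fin n) ℂ X}
    (hx : IsUnconditionalWith 1 x) [Fintype {j : Fin m → Fin n // Monotone j}]
    {θ : Fin n → ℂ} (hθ : ∀ i, ‖θ i‖ ≤ 1)
    (a : {j : Fin m → Fin n // Monotone j} → ℂ) :
    ‖∑ j, (multisetMonomial (Multiset.map j.1 Finset.univ.val) θ * a j) •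
        sym α fun i => x (j.1 i)‖ ≤
      ‖∑ j, a j • sym α fun i => x (j.1 i)‖ := by
  -- `d` is the diagonal map of `X`
  let d₀ : X →ₗ[ℂ] X := x.constr ℂ fun i => θ i • x i
  have hd₀ : ∀ v, ‖d₀ v‖ ≤ 1 * ‖v‖ := by
    intro v
    have h := hx Finset.univ θ (x.repr v) hθ
    rw [x.sum_repr, NNReal.coe_one] at h
    refine Eq.trans_le ?_ h
    rw [Module.Basis.constr_apply_fintype]
    congr 1
    refine Finset.sum_congr rfl fun i _ => ?_
    rw [smul_smul, mul_comm]
    rfl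
  let d : X →L[ℂ] X := d₀.mkContinuous 1 hd₀
  have hdx : ∀ i, d (x i) = θ i • x i := fun i => x.constr_basis ℂ _ i
  refine norm_le_of_toTensor_eq_map d (fun v => (hd₀ v).trans_eq (one_mul _)) ?_
  simp only [map_sum, map_smul, toTensor_sym]
  refine Finset.sum_congr rfl fun j _ => ?_
  rw [mul_comm, mul_smul]
  congr 1
  rw [smul_comm]
  congr 1
  rw [Finset.smul_sum]
  refine Finset.sum_congr rfl fun σ _ => ?_
  rw [PiTensorProduct.map_tprod]
  simp only [ContinuousLinearMap.coe_coe, hdx]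
  rw [MultilinearMap.map_smul_univ, multisetMonomial_map_univ,
    Equiv.prod_comp σ fun i => θ (j.1 i)]

theorem unconditionalConstant_sym_le {x : Module.Basis (Fin n) ℂ X}
    (hx : IsUnconditionalWith 1 x) :
    unconditionalConstant (fun j : {j : Fin m → Fin n // Monotone j} =>
        sym α fun i => x (j.1 i)) ≤
      ((2 * m).choose m : ℝ≥0∞) * gordonLewis (SymTensorPower m X α) := by
  have : Fintype {j : Fin m → Fin n // Monotone j} := Fintype.ofFinite _
  have h := unconditionalConstant_le_choose_mul_gordonLewis (n := n) (symBasis α m x)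
    (w := fun j => Multiset.map j.1 Finset.univ.val)
    (fun j j' h => Subtype.ext (eq_of_map_univ_eq j.2 j'.2 h)) (fun j => card_map_univ j.1)
    (fun g a => by
      simp only [coe_symBasis]
      exact norm_sum_torus_smul_sym_le hx (fun i => (norm_torusPoint g i).le) a)
  rwa [coe_symBasis] at h

end SymTensorPower

/-! ### The constants -/

theorem succ_mul_pow_le_succ_pow (a k : ℕ) : (k + 1) * a ^ k ≤ (a + 1) ^ (k + 1) := by
  induction k with
  | zero => simp
  | succ k ih =>
    calc (k + 1 + 1) * a ^ (k + 1) = (k + 1) * a ^ k * a + a ^ (k + 1) := by ring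
      _ ≤ (a + 1) ^ (k + 1) * a + (a + 1) ^ (k + 1) := by gcongr; omega
      _ = _ := by ring

/-- In the step from `m` to `m + 1` the right side has to gain the factor `(2m + 2)(2m + 1)`, which
is the content of `succ_mul_pow_le_succ_pow` with exponent `2m`. -/
theorem factorial_two_mul_le (m : ℕ) : (2 * m).factorial ≤ 2 ^ m * (m ^ m) ^ 2 := by
  induction m with
  | zero => simp
  | succ m ih =>
    have h := succ_mul_pow_le_succ_pow m (2 * m)
    calc (2 * (m + 1)).factorial = 2 * (m + 1) * (2 * m + 1) * (2 * m).factorial := by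
          rw [show 2 * (m + 1) = 2 * m + 1 + 1 by ring, Nat.factorial_succ, Nat.factorial_succ]
          ring
      _ ≤ 2 * (m + 1) * (2 * m + 1) * (2 ^ m * (m ^ m) ^ 2) := by gcongr
      _ = 2 ^ (m + 1) * (m + 1) * ((2 * m + 1) * m ^ (2 * m)) := by ring
      _ ≤ 2 ^ (m + 1) * (m + 1) * (m + 1) ^ (2 * m + 1) := by gcongr
      _ = _ := by ring

theorem choose_two_mul_le (m : ℕ) :
    ((2 * m).choose m : ℝ≥0∞) ≤ ((m : ℝ≥0∞) ^ m / (Nat.factorial m : ℝ≥0∞)) ^ 2 * 2 ^ m := by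
  have hf0 : (Nat.factorial m : ℝ≥0∞) ≠ 0 := by exact_mod_cast Nat.factorial_ne_zero m
  have hft : (Nat.factorial m : ℝ≥0∞) ≠ ∞ := ENNReal.natCast_ne_top _
  have h : (2 * m).choose m * m.factorial ^ 2 ≤ 2 ^ m * (m ^ m) ^ 2 := by
    have h1 := Nat.choose_mul_factorial_mul_factorial (show m ≤ 2 * m by omega)
    rw [show 2 * m - m = m by omega] at h1
    rw [sq, ← mul_assoc, h1]
    exact factorial_two_mul_le m
  rw [ENNReal.div_eq_inv_mul, mul_pow, mul_assoc, ← ENNReal.inv_pow, ← ENNReal.div_eq_inv_mul,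
    ENNReal.le_div_iff_mul_le (Or.inl (pow_ne_zero 2 hf0)) (Or.inl (ENNReal.pow_ne_top hft)),
    mul_comm (_ ^ 2) (2 ^ m)]
  exact_mod_cast h

theorem proposition4p1 :
    (∃ C : ℝ≥0, 1 ≤ C ∧ ∀ m n : ℕ, 1 ≤ m → 1 ≤ n → ∀ N : CnNorm n,
      IsUnconditionalWith 1 N.unitVector →
        unconditionalConstant (HomPoly.monomial N m) ≤
          (C : ℝ≥0∞) ^ m * gordonLewis (HomPoly N m)) ∧
    (∀ (m n : ℕ), 1 ≤ m → 1 ≤ n →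
      ∀ (X : Type*) [NormedAddCommGroup X] [NormedSpace ℂ X] (x : Module.Basis (Fin n) ℂ X),
      IsUnconditionalWith 1 x → ∀ α : SymTensorNorm,
        unconditionalConstant (fun j : {j : Fin m → Fin n // Monotone j} =>
            SymTensorPower.sym α (fun i => x (j.1 i))) ≤
          ((m : ℝ≥0∞) ^ m / (Nat.factorial m : ℝ≥0∞)) ^ 2 * 2 ^ m *
            gordonLewis (SymTensorPower m X α)) := by
  refine ⟨⟨4, by norm_num, fun m n _ _ N hN => ?_⟩, fun m n _ _ X _ _ x hx α => ?_⟩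
  · refine (HomPoly.unconditionalConstant_monomial_le hN).trans ?_
    gcongr
    have h : (2 * m).choose m ≤ 4 ^ m :=
      (Nat.choose_le_two_pow (2 * m) m).trans_eq (by rw [pow_mul]; norm_num)
    exact_mod_cast h
  · exact (SymTensorPower.unconditionalConstant_sym_le hx).trans
      (by gcongr; exact choose_two_mul_le m)
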